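/- Fix $T>0$ and $\lambda=(\lambda_m)_{m\ge1}\in\Lambda[0,T]$, i.e. a nested sequence of partitions $\lambda_m=\{0=t_0^m<\dots<t_{n(m)}^m=T\}$ of $[0,T]$ with $\bigcup_m\lambda_m$ dense in $[0,T]$. For $0\le u<v\le T$ put $x_i^m=(t_i^m\wedge v)\vee u$. A function is regulated if its finite one-sided limits exist; $\Delta^-f(t)=f(t)-f(t-)$, $\Delta^+f(t)=f(t+)-f(t)$, with $\Delta^-f(0)=\Delta^+f(T)=0$. A regulated function $f$ on $[0,T]$ has the quadratic $\lambda$-variation, with bracket function $[f]_\lambda$, if $[f]_\lambda$ is regulated, $[f]_\lambda(0)=0$, $[f]_\lambda(v)-[f]_\lambda(u)=\lim_m\sum_i (f(x_i^m)-f(x_{i-1}^m))^2$ for all $0\le u<v\le T$, and $\Delta^\pm[f]_\lambda=(\Delta^\pm f)^2$. Its continuous part is $[f]^c_\lambda(t)=[f]_\lambda(t)-\sum_{(0,t]}(\Delta^-f)^2-\sum_{[0,t)}(\Delta^+f)^2$, and the Doléans exponential is $\mathcal E_\lambda(f;0)=1$ and $$\mathcal E_\lambda(f;t)=e^{f(t)-f(0)-\frac12[f]^c_\lambda(t)}\prod_{(0,t]}(1+\Delta^-f)e^{-\Delta^-f}\prod_{[0,t)}(1+\Delta^+f)e^{-\Delta^+f}\qquad(0<t\le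 T)$$ (for continuous $f$, simply $e^{f(t)-f(0)-\frac12[f]_\lambda(t)}$). For a regulated function $g$ on $[0,T]$ and a function $\phi$ on $[0,T]$ such that $\phi(t-)$ exists whenever $\Delta^-g(t)\ne0$, the Left Cauchy $\lambda$-integral $(LC)\!\int\phi\,d_\lambda g$ is defined on $I=[0,T]$ (resp. $I=[0,T)$) if there is a regulated function $\Phi$ on $I$ with $\Phi(0)=0$ such that $\Phi(v)-\Phi(u)=\lim_m\sum_i\phi(x_{i-1}^m)[g(x_i^m)-g(x_{i-1}^m)]$ for all $u<v$ in $I$; $\Delta^-\Phi(v)=\phi(v-)\Delta^-g(v)$ (read as $0$ if $\Delta^-g(v)=0$) for $0<v\in I$; and $\Delta^+\Phi(u)=\phi(u)\Delta^+g(u)$ for $0\le u<T$. Then $(LC)\!\int_u^v\phi\,d_\lambda g:=\Phi(v)-\Phi(u)$. Let $L_\lambda$ be the set of functions $f$ on $[0,T]$ having the quadratic $\lambda$-variation with $f(0)=1$, $\inf f>0$ and $\{t\in(0,T):\Delta^+f(t)\neq0\}\subset\bigcup_m\lambda_m$, and $E_\lambda$ the set of functions $g$ on $[0,T]$ having the quadratic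 $\lambda$-variation with $g(0)=0$, $\inf(1+\Delta^-g\wedge\Delta^+g)>0$ and $\{t\in(0,T):\Delta^+g(t)\neq0\}\subset\bigcup_m\lambda_m$. A stock of the $\lambda$-evolutionary model is a set $P\subset L_\lambda$ for which some $X\subset E_\lambda$ is the image of $P$ under $f\mapsto(LC)\!\int_0^{\,\cdot}f^{-1}\,d_\lambda f$. A portfolio is a finite family $(P_k)_k$ of stocks; a price scenario $(S_k)_k$ chooses one element $S_k\in P_k$ for every $k$. A $\lambda$-trading strategy for a portfolio assigns to each price scenario functions $\gamma_k$ on $[0,T]$ such that, for every $k$, $(LC)\!\int\gamma_k\,d_\lambda S_k$ is defined on $[0,T)$, $\Delta^-S_k(T)=0$ whenever $\gamma_k(T-)$ does not exist, and the limit $(LC)\!\int_0^{T-}\gamma_k\,d_\lambda S_k:=\lim_{u\uparrow T}(LC)\!\int_0^u\gamma_k\,d_\lambda S_k$ exists; $(LC)\!\int_0^{T}\gamma_k\,d_\lambda S_k$ is this limit, plus $\gamma_k(T-)\Delta^-S_k(T)$ if $\gamma_k(T-)$ exists. It is self-financing if $V(t)=V(0)+G(t)$ for every price scenario and every $t\in[0,T]$,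 where $V(t)=\sum_k\gamma_k(t)S_k(t)$ and $G(t)=\sum_k(LC)\!\int_0^t\gamma_k\,d_\lambda S_k$. **Theorem.** Let $1\le p<2$ and $\sigma,r,K>0$. Let $X$ be a set of functions $w=g+h$ on $[0,T]$, where $g$ is continuous and has the quadratic $\lambda$-variation with $[g]_\lambda(t)=\sigma^2t$ for $0\le t\le T$, $h$ is continuous of bounded $p$-variation, and $g(0)=h(0)=0$. Consider the portfolio $(Q,P)$, where $Q$ is the bond with the single price scenario $Q(t)=e^{rt}$ and $P=\mathcal E_\lambda(X)=\{\mathcal E_\lambda(w):w\in X\}$. Let $N$ be the standard normal distribution function and, for $0\le t<T$ and $x>0$, $$d_1(t,x)=\frac{\ln(x/K)+(r+\sigma^2/2)(T-t)}{\sigma\sqrt{T-t}},\qquad d_2(t,x)=d_1(t,x)-\sigma\sqrt{T-t},$$ $$\phi(t,x)=xN(d_1(t,x))-Ke^{-r(T-t)}N(d_2(t,x)),\qquad \phi(T,x)=\max\{0,x-K\}.$$ For a price scenario $(Q,P)$ put $\beta(t)=N(d_1(t,P(t)))$ for $0\le t<T$, $\beta(T)=0$, and $\alpha(t)=\{\phi(t,P(t))-P(t)\beta(t)\}/Q(t)$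 for $0\le t\le T$. Then $(\alpha,\beta)$ is a self-financing $\lambda$-trading strategy for the portfolio $(Q,P)$, and for every price scenario its terminal value is $V(T)=\max\{0,P(T)-K\}$. -/

import Mathlib

open Filter Topology Set

noncomputable section

namespace PathwiseBS

/-! ### Partitions and partition sums -/

/-- A partition `a = x₀ < x₁ < ⋯ < xₙ = b` of the closed interval `[a, b]`; only the values of
`pt` at the indices `0, …, n` matter. -/
structure IntervalPartition (a b : ℝ) where
  n : ℕ
  pt : ℕ → ℝ
  pt_zero : pt 0 = a
  pt_last : pt n = b
  strictMonoOn : StrictMonoOn pt (Iic n)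

/-- The set of points of a partition. -/
def IntervalPartition.points {a b : ℝ} (κ : IntervalPartition a b) : Set ℝ :=
  κ.pt '' Iic κ.n

/-- The class `Λ[a,b]`: nested sequences of partitions of `[a,b]` whose union is dense
in `[a,b]`. -/
structure PartitionSeq (a b : ℝ) where
  part : ℕ → IntervalPartition a b
  nested : ∀ m, (part m).points ⊆ (part (m + 1)).points
  dense : Icc a b ⊆ closure (⋃ m, (part m).points)

/-- The set `∪λ` of all partition points. -/
def PartitionSeq.points {a b : ℝ} (l : PartitionSeq a b) : Set ℝ :=
  ⋃ m, (l.part m).points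

/-- The points `(xᵢ ∧ v) ∨ u` of the partition of `[u,v]` induced by `κ`
(with repetitions, which contribute nothing to the sums below). -/
def IntervalPartition.trace {a b : ℝ} (κ : IntervalPartition a b) (u v : ℝ) (i : ℕ) : ℝ :=
  max u (min (κ.pt i) v)

/-- `s_p(f; x) = ∑ |f(xᵢ) - f(xᵢ₋₁)|^p` along the finite sequence `x₀, …, xₙ`. -/
def powSum (p : ℝ) (f : ℝ → ℝ) (n : ℕ) (x : ℕ → ℝ) : ℝ :=
  ∑ i ∈ Finset.range n, |f (x (i + 1)) - f (x i)| ^ p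

/-- The left Cauchy sum `∑ φ(xᵢ₋₁) [g(xᵢ) - g(xᵢ₋₁)]` along `x₀, …, xₙ`. -/
def leftCauchySum (φ g : ℝ → ℝ) (n : ℕ) (x : ℕ → ℝ) : ℝ :=
  ∑ i ∈ Finset.range n, φ (x i) * (g (x (i + 1)) - g (x i))

/-! ### Regulated functions and `p`-variation

A function on `[a,b]` is represented by a function `ℝ → ℝ`; no definition below uses its values
outside `[a,b]`. -/

/-- The left limit `f(t-)` exists (and is finite). -/
def HasLeftLim (f : ℝ → ℝ) (t : ℝ) : Prop := ∃ y, Tendsto f (𝓝[<] t) (𝓝 y)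

/-- The right limit `f(t+)` exists (and is finite). -/
def HasRightLim (f : ℝ → ℝ) (t : ℝ) : Prop := ∃ y, Tendsto f (𝓝[>] t) (𝓝 y)

/-- `f` is regulated: it has left limits on `(a,b]` and right limits on `[a,b)`. This is the
notion for functions on `[a,b]` as well as for functions on `[a,b)`. -/
def Regulated (a b : ℝ) (f : ℝ → ℝ) : Prop :=
  (∀ t ∈ Ioc a b, HasLeftLim f t) ∧ (∀ t ∈ Ico a b, HasRightLim f t)

/-- `Δ⁻f(t) = f(t) - f(t-)`, and `0` at the left endpoint `a`. -/
def leftJump (a : ℝ) (f : ℝ → ℝ) (t : ℝ) : ℝ :=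
  if t ≤ a then 0 else f t - Function.leftLim f t

/-- `Δ⁺f(t) = f(t+) - f(t)`, and `0` at the right endpoint `b`. -/
def rightJump (b : ℝ) (f : ℝ → ℝ) (t : ℝ) : ℝ :=
  if b ≤ t then 0 else Function.rightLim f t - f t

/-- `f` has bounded `p`-variation on `[a,b]`. -/
def BoundedPVariation (p a b : ℝ) (f : ℝ → ℝ) : Prop :=
  BddAbove (range fun κ : IntervalPartition a b => powSum p f κ.n κ.pt)

/-! ### The quadratic `λ`-variation and the bracket function -/

section Lambda

variable {a b : ℝ}

/-- `f` has the quadratic `λ`-variation on `[a,b]`, with bracket function `H`. -/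
structure HasBracket (l : PartitionSeq a b) (f H : ℝ → ℝ) : Prop where
  regulated : Regulated a b f
  regulated_bracket : Regulated a b H
  bracket_left : H a = 0
  tendsto : ∀ s ∈ Icc a b, ∀ t ∈ Icc a b, s < t →
    Tendsto (fun m => powSum 2 f (l.part m).n ((l.part m).trace s t)) atTop (𝓝 (H t - H s))
  leftJump_eq : ∀ t ∈ Ioc a b, leftJump a H t = leftJump a f t ^ 2
  rightJump_eq : ∀ s ∈ Ico a b, rightJump b H s = rightJump b f s ^ 2

/-- The class `Q_λ[a,b]` of functions having the quadratic `λ`-variation. -/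
def HasQuadVar (l : PartitionSeq a b) (f : ℝ → ℝ) : Prop := ∃ H, HasBracket l f H

/-- The bracket function `[f]_λ(t) = lim_m s₂(f; λ_m ⋒ [a,t])`. -/
def bracket (l : PartitionSeq a b) (f : ℝ → ℝ) (t : ℝ) : ℝ :=
  limUnder atTop fun m => powSum 2 f (l.part m).n ((l.part m).trace a t)

/-- The continuous part `[f]^c_λ` of the bracket function. -/
def bracketCont (l : PartitionSeq a b) (f : ℝ → ℝ) (t : ℝ) : ℝ :=
  bracket l f t - ∑' s : Ioc a t, leftJump a f s ^ 2 - ∑' s : Ico a t, rightJump b f s ^ 2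

/-- The forward Doléans exponential
`ℰ_λ(f;t) = exp {f(t) - f(a) - ½[f]^c_λ(t)} ∏_{[a,t]} (1 + Δf) e^{-Δf}`. -/
def doleans (l : PartitionSeq a b) (f : ℝ → ℝ) (t : ℝ) : ℝ :=
  if t = a then 1 else
    Real.exp (f t - f a - bracketCont l f t / 2) *
      ((∏' s : Ioc a t, (1 + leftJump a f s) * Real.exp (-leftJump a f s)) *
        ∏' s : Ico a t, (1 + rightJump b f s) * Real.exp (-rightJump b f s))

/-! ### The Left Cauchy `λ`-integral -/

/-- The Left Cauchy `λ`-integral `(LC)∫ φ d_λ g` is defined on `I` (either `[a,b]` or `[a,b)`),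
with indefinite integral `Φ`. -/
structure IsLeftCauchyIntegral (l : PartitionSeq a b) (I : Set ℝ) (φ g Φ : ℝ → ℝ) : Prop where
  regulated_integrator : Regulated a b g
  leftLim_integrand : ∀ t ∈ Ioc a b, leftJump a g t ≠ 0 → HasLeftLim φ t
  regulated : Regulated a b Φ
  map_left : Φ a = 0
  tendsto : ∀ u ∈ I, ∀ v ∈ I, u < v →
    Tendsto (fun m => leftCauchySum φ g (l.part m).n ((l.part m).trace u v)) atTop
      (𝓝 (Φ v - Φ u))
  leftJump_eq : ∀ v ∈ I, a < v → leftJump a Φ v =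
    if leftJump a g v = 0 then 0 else Function.leftLim φ v * leftJump a g v
  rightJump_eq : ∀ u ∈ I, u < b → rightJump b Φ u = φ u * rightJump b g u

/-- The value `(LC)∫_u^v φ d_λ g` (meaningful where the integral is defined). -/
def leftCauchyIntegral (l : PartitionSeq a b) (φ g : ℝ → ℝ) (u v : ℝ) : ℝ :=
  limUnder atTop fun m => leftCauchySum φ g (l.part m).n ((l.part m).trace u v)

/-! ### The `λ`-evolutionary model -/

/-- The class `L_λ[a,b]` of price scenarios. -/
def priceClass (l : PartitionSeq a b) : Set (ℝ → ℝ) :=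
  {f | HasQuadVar l f ∧ f a = 1 ∧ (∃ c > 0, ∀ t ∈ Icc a b, c ≤ f t) ∧
    ∀ t ∈ Ioo a b, rightJump b f t ≠ 0 → t ∈ l.points}

/-- The class `E_λ[a,b]` of returns. -/
def returnClass (l : PartitionSeq a b) : Set (ℝ → ℝ) :=
  {g | HasQuadVar l g ∧ g a = 0 ∧
    (∃ c > 0, ∀ t ∈ Icc a b, c ≤ 1 + min (leftJump a g t) (rightJump b g t)) ∧
    ∀ t ∈ Ioo a b, rightJump b g t ≠ 0 → t ∈ l.points}

/-- `(P, X)` is a `λ`-evolutionary system: `P ⊆ L_λ`, `X ⊆ E_λ`, and the reflexivity mapping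
`f ↦ (LC)∫ f⁻¹ d_λ f` carries `P` onto `X` (as sets of functions on `[a,b]`). -/
structure IsEvolutionarySystem (l : PartitionSeq a b) (P X : Set (ℝ → ℝ)) : Prop where
  price_mem : P ⊆ priceClass l
  return_mem : X ⊆ returnClass l
  maps_to : ∀ f ∈ P, ∃ g ∈ X, IsLeftCauchyIntegral l (Icc a b) (fun t => (f t)⁻¹) f g
  onto : ∀ g ∈ X, ∃ f ∈ P, IsLeftCauchyIntegral l (Icc a b) (fun t => (f t)⁻¹) f g

/-- `P` is a stock of the `λ`-evolutionary model. -/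
def IsStock (l : PartitionSeq a b) (P : Set (ℝ → ℝ)) : Prop :=
  ∃ X, IsEvolutionarySystem l P X

end Lambda

/-! ### Trading strategies on `[0,T]`

A portfolio of `n` stocks is a family `P` of sets of functions; a scenario `S` chooses one
element of each of them. A strategy assigns to each scenario a vector of functions. -/

section Trading

variable {T : ℝ} {n : ℕ}

/-- `S` is a price scenario of the portfolio `P`. -/
def IsScenario (P : Fin n → Set (ℝ → ℝ)) (S : Fin n → ℝ → ℝ) : Prop := ∀ k, S k ∈ P k

/-- `(LC)∫_0^{T-} γ d_λ S = lim_{u ↑ T} (LC)∫_0^u γ d_λ S`. -/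
def gainBeforeEnd (l : PartitionSeq 0 T) (γ S : ℝ → ℝ) : ℝ :=
  limUnder (𝓝[<] T) fun u => leftCauchyIntegral l γ S 0 u

open Classical in
/-- The gain `(LC)∫_0^t γ d_λ S`, `0 ≤ t ≤ T`: the Left Cauchy `λ`-integral for `t < T`, and
`γ(T-)Δ⁻S(T) + (LC)∫_0^{T-} γ d_λ S` or `(LC)∫_0^{T-} γ d_λ S` for `t = T`, according to
whether `γ(T-)` exists or not. -/
def gainIntegral (l : PartitionSeq 0 T) (γ S : ℝ → ℝ) (t : ℝ) : ℝ :=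
  if t < T then leftCauchyIntegral l γ S 0 t
  else if HasLeftLim γ T then Function.leftLim γ T * leftJump 0 S T + gainBeforeEnd l γ S
  else gainBeforeEnd l γ S

/-- `γ` is a `λ`-trading strategy for a single price scenario `S`. -/
structure IsTradingStrategyFor (l : PartitionSeq 0 T) (γ S : ℝ → ℝ) : Prop where
  integral_defined : ∃ Φ, IsLeftCauchyIntegral l (Ico 0 T) γ S Φ
  leftJump_eq_zero : ¬ HasLeftLim γ T → leftJump 0 S T = 0
  limit_exists : ∃ y, Tendsto (fun u => leftCauchyIntegral l γ S 0 u) (𝓝[<] T) (𝓝 y)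

/-- `γ` is a `λ`-trading strategy for the portfolio `P` of stocks of the `λ`-evolutionary
model. -/
structure IsTradingStrategy (l : PartitionSeq 0 T) (P : Fin n → Set (ℝ → ℝ))
    (γ : (Fin n → ℝ → ℝ) → Fin n → ℝ → ℝ) : Prop where
  isStock : ∀ k, IsStock l (P k)
  strategy : ∀ S, IsScenario P S → ∀ k, IsTradingStrategyFor l (γ S k) (S k)

/-- The portfolio value function `V`. -/
def portfolioValue (γ : (Fin n → ℝ → ℝ) → Fin n → ℝ → ℝ) (S : Fin n → ℝ → ℝ) (t : ℝ) : ℝ :=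
  ∑ k, γ S k t * S k t

/-- The portfolio gain function `G`. -/
def portfolioGain (l : PartitionSeq 0 T) (γ : (Fin n → ℝ → ℝ) → Fin n → ℝ → ℝ)
    (S : Fin n → ℝ → ℝ) (t : ℝ) : ℝ :=
  ∑ k, gainIntegral l (γ S k) (S k) t

/-- The strategy `γ` is self-financing. -/
def IsSelfFinancing (l : PartitionSeq 0 T) (P : Fin n → Set (ℝ → ℝ))
    (γ : (Fin n → ℝ → ℝ) → Fin n → ℝ → ℝ) : Prop :=
  ∀ S, IsScenario P S → ∀ t ∈ Icc 0 T,
    portfolioValue γ S t = portfolioValue γ S 0 + portfolioGain l γ S t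

end Trading

/-! ### The Black–Scholes model and hedge -/

/-- The class `CQ_{λ,σ}[0,T]`. -/
def contQuadVarClass {T : ℝ} (l : PartitionSeq 0 T) (σ : ℝ) : Set (ℝ → ℝ) :=
  {g | ContinuousOn g (Icc 0 T) ∧ HasQuadVar l g ∧ ∀ t ∈ Icc 0 T, bracket l g t = σ ^ 2 * t}

/-- The class `CW_p[0,T]`. -/
def contPVarClass (T p : ℝ) : Set (ℝ → ℝ) :=
  {h | ContinuousOn h (Icc 0 T) ∧ BoundedPVariation p 0 T h}

/-- The class `X_{λ,p,σ}[0,T]`. -/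
def mixedReturnClass {T : ℝ} (l : PartitionSeq 0 T) (p σ : ℝ) : Set (ℝ → ℝ) :=
  {w | ∃ g ∈ contQuadVarClass l σ, ∃ h ∈ contPVarClass T p, g 0 = 0 ∧ h 0 = 0 ∧ w = g + h}

/-- The standard normal distribution function `N`. -/
def stdNormalCDF (x : ℝ) : ℝ := ProbabilityTheory.cdf (ProbabilityTheory.gaussianReal 0 1) x

def d₁ (σ r K T t x : ℝ) : ℝ :=
  (Real.log (x / K) + (r + σ ^ 2 / 2) * (T - t)) / (σ * √(T - t))

def d₂ (σ r K T t x : ℝ) : ℝ := d₁ σ r K T t x - σ * √(T - t)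

/-- The Black–Scholes value `φ(t,x)` of a call option, for `0 ≤ t ≤ T` and `x ≥ 0`. -/
def callValue (σ r K T t x : ℝ) : ℝ :=
  if 0 < x then
    if t < T then
      x * stdNormalCDF (d₁ σ r K T t x)
        - K * Real.exp (-r * (T - t)) * stdNormalCDF (d₂ σ r K T t x)
    else max 0 (x - K)
  else 0

/-- The bond price `Q(t) = e^{rt}`. -/
def bond (r t : ℝ) : ℝ := Real.exp (r * t)

/-- The number `β` of stock shares, for the stock price scenario `P`. -/
def hedgeStock (σ r K T : ℝ) (P : ℝ → ℝ) (t : ℝ) : ℝ :=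
  if t < T then stdNormalCDF (d₁ σ r K T t (P t)) else 0

/-- The number `α` of bond units, for the price scenario `(Q, P)`. -/
def hedgeBond (σ r K T : ℝ) (Q P : ℝ → ℝ) (t : ℝ) : ℝ :=
  (callValue σ r K T t (P t) - P t * hedgeStock σ r K T P t) / Q t

/-- The Black–Scholes hedge `(α, β)`. -/
def bsHedge (σ r K T : ℝ) (S : Fin 2 → ℝ → ℝ) : Fin 2 → ℝ → ℝ :=
  ![hedgeBond σ r K T (S 0) (S 1), hedgeStock σ r K T (S 1)]

/-- The bond/stock portfolio `(Q, P)` with `P = ℰ_λ(X)`. -/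
def bsPortfolio {T : ℝ} (l : PartitionSeq 0 T) (r : ℝ) (X : Set (ℝ → ℝ)) :
    Fin 2 → Set (ℝ → ℝ) :=
  ![{bond r}, doleans l '' X]

end PathwiseBS

end

noncomputable section

namespace PathwiseBS

/-! ### Mesh of the partitions and sums of interval functions -/

section Germ

variable {a b : ℝ}

/-! All paths are continuous, so every jump condition is trivial and only limits of partition sums
remain. They all come from `tendsto_germSum_of_expansion`: if `y` has quadratic variation `κ t` and
`G s t` equals `F t - F s + p s (t - s) + q s (y t - y s)²` up to a uniformly small multiple of `(t
- s) + (y t - y s)²`, then the sums of `G` tend to the increment of `F` plus `∫ (p + κ q)`.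

A continuous `h` of bounded `p`-variation, `p < 2`, has zero quadratic variation, so by
Cauchy–Schwarz `w = g + h` keeps the bracket `σ² t`. Hence the stock price is `e^y` with `y = w - σ²
t / 2`, and `y` has the bracket `σ² t` too.

In the log price `x`, write the option value as `F = stockPart - bondPart`, with `stockPart = e^x
N(d₁)` and `bondPart = K e^{-r(T-t)} N(d₂)`. Then `F_x = stockPart` and `F_t + σ²/2 (F_xx - F_x) =
-r bondPart` (the Black–Scholes equation). The pathwise Itô formula
`tendsto_germSum_exp_of_hasDerivAt` gives the stock gain `ΔF + ∫ r bondPart` (`tendsto_stock_gain`),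
and the bond gain is `-∫ r bondPart` (`tendsto_bond_gain`). The gains add up to `ΔF`, which is
self-financing before maturity. At `T` the value extends continuously to the pay-off
(`tendsto_logCallValue`) and `bondPart` is bounded by `K`, so both gains have limits. -/

theorem IntervalPartition.pt_mem (κ : IntervalPartition a b) {i : ℕ} (hi : i ≤ κ.n) :
    κ.pt i ∈ Icc a b := by
  constructor
  · have := κ.strictMonoOn.monotoneOn (mem_Iic.2 (Nat.zero_le _)) (mem_Iic.2 hi) (Nat.zero_le i)
    rwa [κ.pt_zero] at this
  · have := κ.strictMonoOn.monotoneOn (mem_Iic.2 hi) (mem_Iic.2 le_rfl) hi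
    rwa [κ.pt_last] at this

theorem IntervalPartition.pt_lt_succ (κ : IntervalPartition a b) {i : ℕ} (hi : i < κ.n) :
    κ.pt i < κ.pt (i + 1) :=
  κ.strictMonoOn (mem_Iic.2 hi.le) (mem_Iic.2 hi) (Nat.lt_succ_self i)

theorem PartitionSeq.points_mono (l : PartitionSeq a b) :
    Monotone fun m => (l.part m).points :=
  monotone_nat_of_le_succ l.nested

/-- The mesh of the partitions tends to zero. -/
theorem PartitionSeq.eventually_mesh_lt (l : PartitionSeq a b) {δ : ℝ} (hδ : 0 < δ) :
    ∀ᶠ m in atTop, ∀ i < (l.part m).n, (l.part m).pt (i + 1) - (l.part m).pt i < δ := by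
  obtain ⟨t, htI, htf, hcov⟩ := (isCompact_Icc (a := a) (b := b)).finite_cover_balls
    (show (0 : ℝ) < δ / 4 by positivity)
  have key : ∀ x ∈ t, ∀ᶠ m in atTop, ∃ q ∈ (l.part m).points, |q - x| < δ / 4 := by
    intro x hx
    obtain ⟨q, hq, hqx⟩ := Metric.mem_closure_iff.1 (l.dense (htI hx)) (δ / 4) (by positivity)
    obtain ⟨m₀, hm₀⟩ := mem_iUnion.1 hq
    filter_upwards [eventually_ge_atTop m₀] with m hm
    refine ⟨q, l.points_mono hm hm₀, ?_⟩
    rw [dist_comm, Real.dist_eq] at hqx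
    exact hqx
  filter_upwards [(htf.eventually_all (p := fun x m => ∃ q ∈ (l.part m).points, |q - x| < δ / 4)).2
    key] with m hm i hi
  -- The midpoint of a cell of length at least `δ` has a net point within `δ/4`, hence a partition
  -- point within `δ/2`; that point would lie strictly inside the cell.
  by_contra! hlt
  set κ := l.part m
  have h1 := κ.pt_mem hi.le
  have h2 := κ.pt_mem (Nat.succ_le_of_lt hi)
  have hc : (κ.pt i + κ.pt (i + 1)) / 2 ∈ Icc a b := by
    constructor
    · linarith [h1.1, h2.1]
    · linarith [h1.2, h2.2]
  obtain ⟨x, hx, hxc⟩ := mem_iUnion₂.1 (hcov hc)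
  obtain ⟨q, ⟨j, hj, rfl⟩, hq⟩ := hm x hx
  rw [Metric.mem_ball, Real.dist_eq, abs_lt] at hxc
  rw [abs_lt] at hq
  have h3 : κ.pt i < κ.pt j := by linarith [hxc.1, hq.1, hxc.2, hq.2]
  have h4 : κ.pt j < κ.pt (i + 1) := by linarith [hxc.1, hq.1, hxc.2, hq.2]
  have h5 := (κ.strictMonoOn.lt_iff_lt (mem_Iic.2 hi.le) hj).1 h3
  have h6 := (κ.strictMonoOn.lt_iff_lt hj (mem_Iic.2 (Nat.succ_le_of_lt hi))).1 h4
  omega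

theorem IntervalPartition.trace_mem (κ : IntervalPartition a b) {u v : ℝ} (huv : u ≤ v) (i : ℕ) :
    κ.trace u v i ∈ Icc u v :=
  ⟨le_max_left _ _, max_le huv (min_le_right _ _)⟩

theorem IntervalPartition.trace_le_succ (κ : IntervalPartition a b) (u v : ℝ) {i : ℕ}
    (hi : i < κ.n) : κ.trace u v i ≤ κ.trace u v (i + 1) :=
  max_le_max le_rfl (min_le_min (κ.pt_lt_succ hi).le le_rfl)

theorem IntervalPartition.trace_zero (κ : IntervalPartition a b) {u v : ℝ} (hu : a ≤ u) :
    κ.trace u v 0 = u := by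
  unfold IntervalPartition.trace
  rw [κ.pt_zero]
  exact max_eq_left (le_trans (min_le_left _ _) hu)

theorem IntervalPartition.trace_last (κ : IntervalPartition a b) {u v : ℝ} (huv : u ≤ v)
    (hv : v ≤ b) : κ.trace u v κ.n = v := by
  unfold IntervalPartition.trace
  rw [κ.pt_last, min_eq_right hv, max_eq_right huv]

theorem abs_clamp_sub_clamp_le (u v x y : ℝ) :
    |max u (min y v) - max u (min x v)| ≤ |y - x| := by
  refine (abs_max_sub_max_le_max _ _ _ _).trans ?_
  rw [sub_self, abs_zero]
  refine max_le (abs_nonneg _) ?_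
  refine (abs_min_sub_min_le_max _ _ _ _).trans ?_
  simp

theorem PartitionSeq.eventually_trace_mesh_lt (l : PartitionSeq a b) {δ : ℝ} (hδ : 0 < δ)
    (u v : ℝ) : ∀ᶠ m in atTop, ∀ i < (l.part m).n,
      |(l.part m).trace u v (i + 1) - (l.part m).trace u v i| < δ := by
  filter_upwards [l.eventually_mesh_lt hδ] with m hm i hi
  refine (abs_clamp_sub_clamp_le _ _ _ _).trans_lt ?_
  rw [abs_of_pos (sub_pos.2 ((l.part m).pt_lt_succ hi))]
  exact hm i hi

/-- The sum of the interval function `G` over the partition of `[u,v]` induced by `λ_m`. -/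
def germSum (l : PartitionSeq a b) (G : ℝ → ℝ → ℝ) (u v : ℝ) (m : ℕ) : ℝ :=
  ∑ i ∈ Finset.range (l.part m).n, G ((l.part m).trace u v i) ((l.part m).trace u v (i + 1))

theorem powSum_two_eq_germSum (l : PartitionSeq a b) (f : ℝ → ℝ) (u v : ℝ) (m : ℕ) :
    powSum 2 f (l.part m).n ((l.part m).trace u v)
      = germSum l (fun s t => (f t - f s) ^ 2) u v m := by
  simp [powSum, germSum]

theorem germSum_self (l : PartitionSeq a b) {G : ℝ → ℝ → ℝ} {u : ℝ} (hG : G u u = 0) (m : ℕ) :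
    germSum l G u u m = 0 := by
  have h : ∀ i, (l.part m).trace u u i = u := fun i =>
    le_antisymm ((l.part m).trace_mem le_rfl i).2 ((l.part m).trace_mem le_rfl i).1
  simp [germSum, h, hG]

theorem germSum_sub (l : PartitionSeq a b) (F : ℝ → ℝ) {u v : ℝ} (hu : a ≤ u) (huv : u ≤ v)
    (hv : v ≤ b) (m : ℕ) : germSum l (fun s t => F t - F s) u v m = F v - F u := by
  unfold germSum
  rw [Finset.sum_range_sub (fun i => F ((l.part m).trace u v i)), (l.part m).trace_zero hu,
    (l.part m).trace_last huv hv]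

theorem abs_germSum_le {l : PartitionSeq a b} {G H : ℝ → ℝ → ℝ} {u v : ℝ} (huv : u ≤ v)
    (h : ∀ s ∈ Icc u v, ∀ t ∈ Icc u v, s ≤ t → |G s t| ≤ H s t) (m : ℕ) :
    |germSum l G u v m| ≤ germSum l H u v m := by
  refine (Finset.abs_sum_le_sum_abs _ _).trans (Finset.sum_le_sum fun i hi => ?_)
  exact h _ ((l.part m).trace_mem huv _) _ ((l.part m).trace_mem huv _)
    ((l.part m).trace_le_succ u v (Finset.mem_range.1 hi))

theorem germSum_add (l : PartitionSeq a b) (G H : ℝ → ℝ → ℝ) (u v : ℝ) (m : ℕ) :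
    germSum l (fun s t => G s t + H s t) u v m = germSum l G u v m + germSum l H u v m :=
  Finset.sum_add_distrib

theorem germSum_const_mul (l : PartitionSeq a b) (c : ℝ) (G : ℝ → ℝ → ℝ) (u v : ℝ) (m : ℕ) :
    germSum l (fun s t => c * G s t) u v m = c * germSum l G u v m :=
  (Finset.mul_sum _ _ _).symm

/-- Sums of a small interval function are asymptotically additive in the interval. -/
theorem tendsto_germSum_split (l : PartitionSeq a b) {G : ℝ → ℝ → ℝ} {u s v : ℝ}
    (hus : u ≤ s) (hsv : s ≤ v) (hdiag : ∀ t ∈ Icc u v, G t t = 0)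
    (hsmall : ∀ ε > 0, ∃ δ > 0, ∀ x ∈ Icc u v, ∀ y ∈ Icc u v, x ≤ y → y - x < δ → |G x y| ≤ ε) :
    Tendsto (fun m => germSum l G u v m - germSum l G u s m - germSum l G s v m) atTop (𝓝 0) := by
  rw [Metric.tendsto_atTop']
  intro ε hε
  obtain ⟨δ, hδ, hG⟩ := hsmall (ε / 4) (by positivity)
  obtain ⟨m₀, hm₀⟩ := eventually_atTop.1 (l.eventually_mesh_lt hδ)
  refine ⟨m₀, fun m hm => ?_⟩
  have hmesh := hm₀ m hm.le
  rw [Real.dist_eq, sub_zero]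
  set κ := l.part m
  -- `d i` is the additivity defect of the `i`-th cell. Unless `s` is interior to the cell, one
  -- clamped half degenerates to `s`, where `G` vanishes, and the other coincides with the whole
  -- clamped cell. At most one cell has `s` in its interior, and it contributes three small values.
  set d : ℕ → ℝ := fun i => G (κ.trace u v i) (κ.trace u v (i + 1))
    - G (κ.trace u s i) (κ.trace u s (i + 1)) - G (κ.trace s v i) (κ.trace s v (i + 1)) with hd
  have hsum : germSum l G u v m - germSum l G u s m - germSum l G s v m
      = ∑ i ∈ Finset.range κ.n, d i := by
    simp only [germSum, hd, Finset.sum_sub_distrib]; rfl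
  rw [hsum]
  have hsI : s ∈ Icc u v := ⟨hus, hsv⟩
  have hleft : ∀ i < κ.n, κ.pt (i + 1) ≤ s → d i = 0 := by
    intro i hi h
    have h' : κ.pt i ≤ s := (κ.pt_lt_succ hi).le.trans h
    simp only [hd, IntervalPartition.trace]
    rw [min_eq_left (h.trans hsv), min_eq_left (h'.trans hsv), min_eq_left h, min_eq_left h',
      max_eq_left h, max_eq_left h', hdiag s hsI]
    ring
  have hright : ∀ i < κ.n, s ≤ κ.pt i → d i = 0 := by
    intro i hi h
    have h' : s ≤ κ.pt (i + 1) := h.trans (κ.pt_lt_succ hi).le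
    simp only [hd, IntervalPartition.trace]
    rw [min_eq_right h, min_eq_right h', max_eq_right hus, hdiag s hsI,
      max_eq_right (le_min h hsv), max_eq_right (le_min h' hsv),
      max_eq_right (hus.trans (le_min h hsv)), max_eq_right (hus.trans (le_min h' hsv))]
    ring
  have hbd : ∀ i < κ.n, |d i| ≤ 3 * (ε / 4) := by
    intro i hi
    have haux : ∀ u' v', u ≤ u' → u' ≤ v' → v' ≤ v →
        |G (κ.trace u' v' i) (κ.trace u' v' (i + 1))| ≤ ε / 4 := by
      intro u' v' h1 h2 h3
      have hsub : Icc u' v' ⊆ Icc u v := Icc_subset_Icc h1 h3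
      refine hG _ (hsub (κ.trace_mem h2 _)) _ (hsub (κ.trace_mem h2 _))
        (κ.trace_le_succ u' v' hi) ?_
      refine (le_abs_self _).trans_lt ((abs_clamp_sub_clamp_le _ _ _ _).trans_lt ?_)
      rw [abs_of_pos (sub_pos.2 (κ.pt_lt_succ hi))]
      exact hmesh i hi
    have e1 := abs_le.1 (haux u v le_rfl (hus.trans hsv) le_rfl)
    have e2 := abs_le.1 (haux u s le_rfl hus hsv)
    have e3 := abs_le.1 (haux s v hus hsv le_rfl)
    rw [abs_le]
    simp only [hd]
    constructor <;> linarith [e1.1, e1.2, e2.1, e2.2, e3.1, e3.2]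
  by_cases hex : ∃ i < κ.n, κ.pt i < s ∧ s < κ.pt (i + 1)
  · obtain ⟨i, hi, h1, h2⟩ := hex
    rw [Finset.sum_eq_single_of_mem i (Finset.mem_range.2 hi)]
    · linarith [hbd i hi]
    · intro j hj hne
      have hj := Finset.mem_range.1 hj
      rcases lt_or_gt_of_ne hne with h | h
      · refine hleft j hj (le_trans ?_ h1.le)
        exact κ.strictMonoOn.monotoneOn (mem_Iic.2 (by omega)) (mem_Iic.2 (by omega)) (by omega)
      · refine hright j hj (le_trans h2.le ?_)
        exact κ.strictMonoOn.monotoneOn (mem_Iic.2 (by omega)) (mem_Iic.2 (by omega)) (by omega)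
  · push Not at hex
    rw [Finset.sum_eq_zero, abs_zero]
    · exact hε
    · intro i hi
      have hi := Finset.mem_range.1 hi
      rcases le_or_gt s (κ.pt i) with h | h
      · exact hright i hi h
      · exact hleft i hi (hex i hi h)

/-- Local estimates of the sums of a small interval function imply their convergence. -/
theorem tendsto_germSum_of_local (l : PartitionSeq a b) {G : ℝ → ℝ → ℝ} {Ψ : ℝ → ℝ} {c d : ℝ}
    (hdiag : ∀ t ∈ Icc c d, G t t = 0)
    (hsmall : ∀ ε > 0, ∃ δ > 0, ∀ x ∈ Icc c d, ∀ y ∈ Icc c d, x ≤ y → y - x < δ → |G x y| ≤ ε)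
    (hloc : ∀ ε > 0, ∃ δ > 0, ∀ u ∈ Icc c d, ∀ v ∈ Icc c d, u < v → v - u < δ →
      ∀ᶠ m in atTop, |germSum l G u v m - (Ψ v - Ψ u)| ≤ ε * (v - u)) (hcd : c ≤ d) :
    Tendsto (germSum l G c d) atTop (𝓝 (Ψ d - Ψ c)) := by
  rw [Metric.tendsto_nhds]
  intro ε hε
  set ε₁ := ε / (2 * (d - c + 1)) with hε₁
  have hdc : 0 < d - c + 1 := by linarith
  have hε₁pos : 0 < ε₁ := by positivity
  obtain ⟨δ, hδ, hl⟩ := hloc ε₁ hε₁pos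
  obtain ⟨N, hN⟩ := exists_nat_gt ((d - c) / δ)
  have hNpos : (0 : ℝ) < N := lt_of_le_of_lt (div_nonneg (by linarith) hδ.le) hN
  set e := (d - c) / N with he
  have he0 : 0 ≤ e := div_nonneg (by linarith) hNpos.le
  have heδ : e < δ := by
    rw [he, div_lt_iff₀ hNpos]; rw [div_lt_iff₀ hδ] at hN; linarith
  have hNe : N * e = d - c := by rw [he]; field_simp
  -- Induction along `N` equal steps, with `N` fixed before `m`. The slack `η` absorbs the splitting
  -- errors, which vanish only as `m → ∞`.
  have main : ∀ j : ℕ, j ≤ N → ∀ η > 0, ∀ᶠ m in atTop,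
      |germSum l G c (c + j * e) m - (Ψ (c + j * e) - Ψ c)| ≤ ε₁ * (j * e) + η := by
    intro j
    induction j with
    | zero =>
      intro _ η hη
      refine Eventually.of_forall fun m => ?_
      simp only [Nat.cast_zero, zero_mul, add_zero, mul_zero, sub_self, zero_add, sub_zero]
      rw [germSum_self l (hdiag c (left_mem_Icc.2 hcd)), abs_zero]
      exact hη.le
    | succ j ih =>
      intro hj η hη
      have hjN : ((j : ℝ) + 1) ≤ N := by exact_mod_cast hj
      have h0 : 0 ≤ j * e := by positivity
      have h2 : c + ((j : ℝ) + 1) * e ≤ d := by nlinarith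
      have hs : c + j * e ∈ Icc c d := ⟨by linarith, by linarith⟩
      have hv : c + ((j : ℝ) + 1) * e ∈ Icc c d := ⟨by linarith, h2⟩
      push_cast
      have hsub : Icc c (c + ((j : ℝ) + 1) * e) ⊆ Icc c d := Icc_subset_Icc le_rfl h2
      have hsplit := tendsto_germSum_split l (G := G) (u := c) (s := c + j * e)
        (v := c + ((j : ℝ) + 1) * e) (by linarith) (by linarith)
        (fun t ht => hdiag t (hsub ht)) (fun ε hε => by
          obtain ⟨δ, hδ, h⟩ := hsmall ε hε
          exact ⟨δ, hδ, fun x hx y hy => h x (hsub hx) y (hsub hy)⟩)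
      have hstep : ∀ᶠ m in atTop, |germSum l G (c + j * e) (c + ((j : ℝ) + 1) * e) m
          - (Ψ (c + ((j : ℝ) + 1) * e) - Ψ (c + j * e))| ≤ ε₁ * e := by
        rcases he0.eq_or_lt with h | h
        · refine Eventually.of_forall fun m => ?_
          simp only [← h, mul_zero, add_zero]
          rw [germSum_self l (hdiag c (left_mem_Icc.2 hcd))]
          simp
        · filter_upwards [hl _ hs _ hv (by linarith) (by linarith)] with m hm
          refine hm.trans (le_of_eq ?_)
          ring
      filter_upwards [ih (by omega) (η / 2) (by positivity), hstep,
        Metric.tendsto_nhds.1 hsplit (η / 2) (by positivity)] with m h1 h2 h3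
      rw [Real.dist_eq, sub_zero, abs_lt] at h3
      rw [abs_le] at h1 h2 ⊢
      constructor <;> linarith [h1.1, h1.2, h2.1, h2.2, h3.1, h3.2]
  have hfin := main N le_rfl (ε / 4) (by positivity)
  filter_upwards [hfin] with m hm
  rw [hNe, add_sub_cancel] at hm
  rw [Real.dist_eq]
  have : ε₁ * (d - c) ≤ ε / 2 := by
    rw [hε₁, div_mul_eq_mul_div, div_le_div_iff₀ (by positivity) (by positivity)]
    nlinarith
  linarith

/-- The convergence of the sums of an interval function that has a second order expansion along a
path `y` with quadratic variation `κ t`. -/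
theorem tendsto_germSum_of_expansion (l : PartitionSeq a b) {G : ℝ → ℝ → ℝ} {F p q y : ℝ → ℝ}
    {κ c d : ℝ} (hκ : 0 ≤ κ) (hac : a ≤ c) (hcd : c ≤ d) (hdb : d ≤ b)
    (hF : ContinuousOn F (Icc c d)) (hp : ContinuousOn p (Icc c d))
    (hq : ContinuousOn q (Icc c d)) (hy : ContinuousOn y (Icc c d))
    (hyQ : ∀ u ∈ Icc c d, ∀ v ∈ Icc c d, u < v →
      Tendsto (germSum l (fun s t => (y t - y s) ^ 2) u v) atTop (𝓝 (κ * (v - u))))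
    (hexp : ∀ ε > 0, ∃ δ > 0, ∀ s ∈ Icc c d, ∀ t ∈ Icc c d, s ≤ t → t - s < δ →
      |G s t - (F t - F s) - p s * (t - s) - q s * (y t - y s) ^ 2|
        ≤ ε * ((t - s) + (y t - y s) ^ 2)) :
    Tendsto (germSum l G c d) atTop
      (𝓝 (F d - F c + ∫ t in c..d, (p t + κ * q t))) := by
  have huc : ∀ f : ℝ → ℝ, ContinuousOn f (Icc c d) → ∀ ε > 0, ∃ δ > 0,
      ∀ s ∈ Icc c d, ∀ t ∈ Icc c d, |t - s| < δ → |f t - f s| < ε := by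
    intro f hf ε hε
    obtain ⟨δ, hδ, h⟩ := Metric.uniformContinuousOn_iff.1
      (isCompact_Icc.uniformContinuousOn_of_continuous hf) ε hε
    exact ⟨δ, hδ, fun s hs t ht hst => h t ht s hs hst⟩
  have hint : ∀ u ∈ Icc c d, ∀ v ∈ Icc c d, u ≤ v →
      IntervalIntegrable (fun t => p t + κ * q t) MeasureTheory.volume u v := by
    intro u hu v hv huv
    refine ContinuousOn.intervalIntegrable ?_
    rw [uIcc_of_le huv]
    exact (hp.add (continuousOn_const.mul hq)).mono (Icc_subset_Icc hu.1 hv.2)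
  set Ψ : ℝ → ℝ := fun t => F t + ∫ s in c..t, (p s + κ * q s) with hΨ
  -- At `s = t` every other term of the expansion vanishes, and so does its error bound.
  have hdiag : ∀ t ∈ Icc c d, G t t = 0 := by
    intro t ht
    obtain ⟨δ, hδ, h⟩ := hexp 1 one_pos
    have := h t ht t ht le_rfl (by simpa using hδ)
    simpa using this
  have hsmall : ∀ ε > 0, ∃ δ > 0, ∀ x ∈ Icc c d, ∀ y ∈ Icc c d, x ≤ y → y - x < δ →
      |G x y| ≤ ε := by
    intro ε hε
    obtain ⟨Cp, hCp⟩ := isCompact_Icc.exists_bound_of_continuousOn hp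
    obtain ⟨Cq, hCq⟩ := isCompact_Icc.exists_bound_of_continuousOn hq
    obtain ⟨δ₁, hδ₁, h₁⟩ := hexp 1 one_pos
    obtain ⟨δ₂, hδ₂, h₂⟩ := huc F hF (ε / 3) (by positivity)
    set M := |Cp| + |Cq| + 1 with hM
    have hMpos : 0 < M := by positivity
    obtain ⟨δ₃, hδ₃, h₃⟩ := huc y hy (min 1 (ε / (3 * M))) (by positivity)
    refine ⟨min (min δ₁ δ₂) (min δ₃ (ε / (3 * M))), by positivity, ?_⟩
    intro s hs t ht hst hlt
    simp only [lt_min_iff] at hlt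
    obtain ⟨⟨l1, l2⟩, l3, l4⟩ := hlt
    have habs : |t - s| = t - s := abs_of_nonneg (by linarith)
    have e1 := h₁ s hs t ht hst l1
    have e2 := h₂ s hs t ht (by rwa [habs])
    have e3 := h₃ s hs t ht (by rwa [habs])
    rw [lt_min_iff] at e3
    have ep : |p s| ≤ M - 1 := (hCp s hs).trans (by linarith [le_abs_self Cp, abs_nonneg Cq])
    have eq : |q s| ≤ M - 1 := (hCq s hs).trans (by linarith [le_abs_self Cq, abs_nonneg Cp])
    have ey : (y t - y s) ^ 2 ≤ ε / (3 * M) := by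
      rw [← sq_abs]; nlinarith [abs_nonneg (y t - y s), e3.1, e3.2]
    have b1 : |p s * (t - s)| ≤ (M - 1) * (t - s) := by
      rw [abs_mul, habs]; gcongr
    have b2 : |q s * (y t - y s) ^ 2| ≤ (M - 1) * (y t - y s) ^ 2 := by
      rw [abs_mul, abs_of_nonneg (sq_nonneg (y t - y s))]; gcongr
    have b3 : M * (t - s) ≤ ε / 3 := by
      calc M * (t - s) ≤ M * (ε / (3 * M)) := by gcongr
        _ = ε / 3 := by field_simp
    have b4 : M * (y t - y s) ^ 2 ≤ ε / 3 := by
      calc M * (y t - y s) ^ 2 ≤ M * (ε / (3 * M)) := by gcongr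
        _ = ε / 3 := by field_simp
    rw [abs_le] at e1 b1 b2 ⊢
    rw [abs_lt] at e2
    constructor <;> linarith [e1.1, e1.2, b1.1, b1.2, b2.1, b2.2, e2.1, e2.2]
  have hloc : ∀ ε > 0, ∃ δ > 0, ∀ u ∈ Icc c d, ∀ v ∈ Icc c d, u < v → v - u < δ →
      ∀ᶠ m in atTop, |germSum l G u v m - (Ψ v - Ψ u)| ≤ ε * (v - u) := by
    intro ε hε
    -- On a short interval `p` and `q` are frozen at the left endpoint `u`. The errors are then
    -- multiples of `ε₁ ((v - u) + Qm)`, and `Qm` tends to `κ (v - u)`; this accounts for the factor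
    -- `1 + κ`.
    set ε₁ := ε / (5 * (1 + κ)) with hε₁
    have hε₁pos : 0 < ε₁ := by positivity
    have hε₁κ : ε₁ * (1 + κ) = ε / 5 := by rw [hε₁]; field_simp
    obtain ⟨δ₁, hδ₁, h₁⟩ := hexp ε₁ hε₁pos
    obtain ⟨δ₂, hδ₂, h₂⟩ := huc p hp ε₁ hε₁pos
    obtain ⟨δ₃, hδ₃, h₃⟩ := huc q hq ε₁ hε₁pos
    refine ⟨min δ₁ (min δ₂ δ₃), by positivity, ?_⟩
    intro u hu v hv huv hlt
    simp only [lt_min_iff] at hlt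
    obtain ⟨l1, l2, l3⟩ := hlt
    have hsub : Icc u v ⊆ Icc c d := Icc_subset_Icc hu.1 hv.2
    have hcl : ∀ s ∈ Icc u v, |s - u| ≤ v - u := fun s hs => by
      rw [abs_of_nonneg (by linarith [hs.1])]; linarith [hs.2]
    have hps : ∀ s ∈ Icc u v, |p s - p u| ≤ ε₁ := fun s hs =>
      (h₂ u hu s (hsub hs) ((hcl s hs).trans_lt l2)).le
    have hqs : ∀ s ∈ Icc u v, |q s - q u| ≤ ε₁ := fun s hs =>
      (h₃ u hu s (hsub hs) ((hcl s hs).trans_lt l3)).le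
    set Qm := germSum l (fun s t => (y t - y s) ^ 2) u v
    have hsum : ∀ m, |germSum l G u v m - (F v - F u) - p u * (v - u) - q u * Qm m|
        ≤ 2 * ε₁ * ((v - u) + Qm m) := by
      intro m
      have h := abs_germSum_le (l := l) huv.le
        (G := fun s t => G s t + ((-1) * (F t - F s)
          + ((-p u) * (t - s) + (-q u) * (y t - y s) ^ 2)))
        (H := fun s t => 2 * ε₁ * ((t - s) + (y t - y s) ^ 2)) (by
          intro s hs t ht hst
          have e1 := h₁ s (hsub hs) t (hsub ht) hst (by linarith [hs.1, ht.2])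
          have b1 : |(p s - p u) * (t - s)| ≤ ε₁ * (t - s) := by
            rw [abs_mul, abs_of_nonneg (show 0 ≤ t - s by linarith)]
            exact mul_le_mul_of_nonneg_right (hps s hs) (by linarith)
          have b2 : |(q s - q u) * (y t - y s) ^ 2| ≤ ε₁ * (y t - y s) ^ 2 := by
            rw [abs_mul, abs_of_nonneg (sq_nonneg (y t - y s))]
            exact mul_le_mul_of_nonneg_right (hqs s hs) (sq_nonneg _)
          rw [abs_le] at e1 b1 b2 ⊢
          constructor <;> linarith [e1.1, e1.2, b1.1, b1.2, b2.1, b2.2]) m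
      simp only [germSum_add, germSum_const_mul] at h
      have hF' := germSum_sub l F (hac.trans hu.1) huv.le (hv.2.trans hdb) m
      have hid := germSum_sub l (fun t => t) (hac.trans hu.1) huv.le (hv.2.trans hdb) m
      rw [hF', hid] at h
      refine le_trans (le_of_eq ?_) h
      congr 1
      ring
    have hI : |(∫ t in u..v, (p t + κ * q t)) - (p u + κ * q u) * (v - u)|
        ≤ ε / 5 * (v - u) := by
      have h := intervalIntegral.norm_integral_le_of_norm_le_const (a := u) (b := v)
        (f := fun t => (p t + κ * q t) - (p u + κ * q u)) (C := ε / 5) (by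
          intro t ht
          rw [uIoc_of_le huv.le] at ht
          have ht' : t ∈ Icc u v := ⟨ht.1.le, ht.2⟩
          have b1 := hps t ht'
          have b2 : |κ * (q t - q u)| ≤ κ * ε₁ := by
            rw [abs_mul, abs_of_nonneg hκ]
            exact mul_le_mul_of_nonneg_left (hqs t ht') hκ
          rw [Real.norm_eq_abs]
          rw [abs_le] at b1 b2 ⊢
          constructor <;> linarith [b1.1, b1.2, b2.1, b2.2])
      rw [intervalIntegral.integral_sub (hint u hu v hv huv.le) (by simp),
        intervalIntegral.integral_const, abs_of_pos (sub_pos.2 huv), Real.norm_eq_abs,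
        smul_eq_mul] at h
      rwa [mul_comm (p u + κ * q u)]
    have hΨuv : Ψ v - Ψ u = F v - F u + ∫ t in u..v, (p t + κ * q t) := by
      have := intervalIntegral.integral_add_adjacent_intervals
        (hint c (left_mem_Icc.2 hcd) u hu hu.1) (hint u hu v hv huv.le)
      simp only [hΨ]
      linarith
    have hvu : 0 < v - u := sub_pos.2 huv
    -- The total coefficient with which the deviation of `Qm` from its limit enters.
    set C := |q u| + 2 * ε₁ with hC
    have hCpos : 0 < C := by positivity
    filter_upwards [Metric.tendsto_nhds.1 (hyQ u hu v hv huv) (ε / 5 * (v - u) / C)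
      (by positivity)] with m hm
    rw [Real.dist_eq] at hm
    have hs := hsum m
    rw [hΨuv]
    change |Qm m - κ * (v - u)| < _ at hm
    have hmC : C * |Qm m - κ * (v - u)| ≤ ε / 5 * (v - u) := by
      rw [lt_div_iff₀ hCpos] at hm; linarith
    have b1 : |q u * (Qm m - κ * (v - u))| = |q u| * |Qm m - κ * (v - u)| := abs_mul _ _
    have b1' := abs_le.1 b1.le
    have b2 := le_abs_self (Qm m - κ * (v - u))
    have b3 : 2 * ε₁ * ((v - u) + Qm m)
        ≤ 2 * (ε / 5) * (v - u) + 2 * ε₁ * |Qm m - κ * (v - u)| := by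
      rw [← hε₁κ]; nlinarith
    rw [hC] at hmC
    rw [abs_le] at hs hI ⊢
    constructor <;> nlinarith [hs.1, hs.2, hI.1, hI.2, b1'.1, b1'.2]
  have h := tendsto_germSum_of_local l hdiag hsmall hloc hcd
  have e : Ψ d - Ψ c = F d - F c + ∫ t in c..d, (p t + κ * q t) := by
    simp only [hΨ, intervalIntegral.integral_same]
    ring
  rwa [e] at h

end Germ

/-! ### Continuous functions on the interval -/

section Continuous

variable {a b : ℝ}

theorem tendsto_left_of_continuousOn {f : ℝ → ℝ} (hf : ContinuousOn f (Icc a b)) {t : ℝ}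
    (ht : t ∈ Ioc a b) : Tendsto f (𝓝[<] t) (𝓝 (f t)) :=
  (hf t ⟨ht.1.le, ht.2⟩).mono_left (nhdsWithin_le_of_mem (Icc_mem_nhdsLT_of_mem ht))

theorem tendsto_right_of_continuousOn {f : ℝ → ℝ} (hf : ContinuousOn f (Icc a b)) {t : ℝ}
    (ht : t ∈ Ico a b) : Tendsto f (𝓝[>] t) (𝓝 (f t)) :=
  (hf t ⟨ht.1, ht.2.le⟩).mono_left (nhdsWithin_le_of_mem (Icc_mem_nhdsGT_of_mem ht))

theorem regulated_of_continuousOn {f : ℝ → ℝ} (hf : ContinuousOn f (Icc a b)) :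
    Regulated a b f :=
  ⟨fun _ ht => ⟨_, tendsto_left_of_continuousOn hf ht⟩,
    fun _ ht => ⟨_, tendsto_right_of_continuousOn hf ht⟩⟩

theorem leftJump_eq_zero_of_continuousOn {f : ℝ → ℝ} (hf : ContinuousOn f (Icc a b)) {t : ℝ}
    (ht : t ≤ b) : leftJump a f t = 0 := by
  unfold leftJump
  split_ifs with h
  · rfl
  · rw [leftLim_eq_of_tendsto
      (tendsto_left_of_continuousOn hf ⟨not_le.1 h, ht⟩), sub_self]

theorem rightJump_eq_zero_of_continuousOn {f : ℝ → ℝ} (hf : ContinuousOn f (Icc a b)) {t : ℝ}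
    (ht : a ≤ t) : rightJump b f t = 0 := by
  unfold rightJump
  split_ifs with h
  · rfl
  · rw [rightLim_eq_of_tendsto
      (tendsto_right_of_continuousOn hf ⟨ht, not_le.1 h⟩), sub_self]

/-- For continuous `g` and `Φ` both sides of each jump condition are zero, and no left limit of `φ`
is required. -/
theorem isLeftCauchyIntegral_of_continuousOn {l : PartitionSeq a b} {I : Set ℝ}
    {φ g Φ : ℝ → ℝ} (hI : I ⊆ Icc a b) (hg : ContinuousOn g (Icc a b))
    (hΦ : ContinuousOn Φ (Icc a b)) (h0 : Φ a = 0)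
    (h : ∀ u ∈ I, ∀ v ∈ I, u < v →
      Tendsto (germSum l (fun s t => φ s * (g t - g s)) u v) atTop (𝓝 (Φ v - Φ u))) :
    IsLeftCauchyIntegral l I φ g Φ where
  regulated_integrator := regulated_of_continuousOn hg
  leftLim_integrand t ht hne := absurd (leftJump_eq_zero_of_continuousOn hg ht.2) hne
  regulated := regulated_of_continuousOn hΦ
  map_left := h0
  tendsto := h
  leftJump_eq v hv _ := by
    rw [leftJump_eq_zero_of_continuousOn hg (hI hv).2, if_pos rfl,
      leftJump_eq_zero_of_continuousOn hΦ (hI hv).2]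
  rightJump_eq u hu _ := by
    rw [rightJump_eq_zero_of_continuousOn hg (hI hu).1,
      rightJump_eq_zero_of_continuousOn hΦ (hI hu).1, mul_zero]

theorem hasBracket_of_continuousOn {l : PartitionSeq a b} {f H : ℝ → ℝ}
    (hf : ContinuousOn f (Icc a b)) (hH : ContinuousOn H (Icc a b)) (h0 : H a = 0)
    (h : ∀ u ∈ Icc a b, ∀ v ∈ Icc a b, u < v →
      Tendsto (germSum l (fun s t => (f t - f s) ^ 2) u v) atTop (𝓝 (H v - H u))) :
    HasBracket l f H where
  regulated := regulated_of_continuousOn hf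
  regulated_bracket := regulated_of_continuousOn hH
  bracket_left := h0
  tendsto s hs t ht hst := by
    simp_rw [powSum_two_eq_germSum]
    exact h s hs t ht hst
  leftJump_eq t ht := by
    rw [leftJump_eq_zero_of_continuousOn hf ht.2, leftJump_eq_zero_of_continuousOn hH ht.2]
    norm_num
  rightJump_eq t ht := by
    rw [rightJump_eq_zero_of_continuousOn hf ht.1, rightJump_eq_zero_of_continuousOn hH ht.1]
    norm_num

theorem exists_abs_sub_lt_of_continuousOn {f : ℝ → ℝ} (hf : ContinuousOn f (Icc a b)) {ε : ℝ}
    (hε : 0 < ε) : ∃ δ > 0, ∀ s ∈ Icc a b, ∀ t ∈ Icc a b, |t - s| < δ → |f t - f s| < ε := by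
  obtain ⟨δ, hδ, h⟩ := Metric.uniformContinuousOn_iff.1
    (isCompact_Icc.uniformContinuousOn_of_continuous hf) ε hε
  exact ⟨δ, hδ, fun s hs t ht hst => h t ht s hs hst⟩

/-- `y` is continuous on `[a,b]` and has the quadratic `λ`-variation with bracket function
`t ↦ κ (t - a)`. -/
structure HasLinearQuadVar (l : PartitionSeq a b) (y : ℝ → ℝ) (κ : ℝ) : Prop where
  continuousOn : ContinuousOn y (Icc a b)
  tendsto : ∀ u ∈ Icc a b, ∀ v ∈ Icc a b, u < v →
    Tendsto (germSum l (fun s t => (y t - y s) ^ 2) u v) atTop (𝓝 (κ * (v - u)))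

theorem HasLinearQuadVar.hasBracket {l : PartitionSeq a b} {y : ℝ → ℝ} {κ : ℝ}
    (h : HasLinearQuadVar l y κ) : HasBracket l y fun t => κ * (t - a) := by
  refine hasBracket_of_continuousOn h.continuousOn (by fun_prop) (by ring) ?_
  intro u hu v hv huv
  convert h.tendsto u hu v hv huv using 2
  ring

end Continuous

/-! ### Perturbation by a function of bounded `p`-variation, `p < 2` -/

section PVariation

variable {a b : ℝ}

/-- Repeated points can be deleted because `0 ^ p = 0`. This is needed since `BoundedPVariation`
ranges over strict partitions, whereas traces repeat points. -/
theorem exists_intervalPartition_powSum_eq {p : ℝ} (hp : p ≠ 0) (f : ℝ → ℝ) (x : ℕ → ℝ) (n : ℕ)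
    (hx : ∀ i < n, x i ≤ x (i + 1)) (ha : x 0 = a) (hb : x n = b) :
    ∃ κ : IntervalPartition a b, powSum p f κ.n κ.pt = powSum p f n x := by
  induction n generalizing b with
  | zero =>
    refine ⟨⟨0, x, ha, hb, ?_⟩, rfl⟩
    intro i hi j hj hij
    simp only [mem_Iic] at hi hj
    omega
  | succ n ih =>
    obtain ⟨κ, hκ⟩ := ih (fun i hi => hx i (by omega)) rfl
    have hstep := hx n (Nat.lt_succ_self n)
    rw [powSum, Finset.sum_range_succ, ← powSum, ← hκ]
    rcases hstep.eq_or_lt with h | h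
    · have hnb : x n = b := h.trans hb
      subst hnb
      refine ⟨κ, ?_⟩
      rw [hb, sub_self, abs_zero, Real.zero_rpow hp, add_zero]
    · refine ⟨⟨κ.n + 1, fun i => if i ≤ κ.n then κ.pt i else b, ?_, ?_, ?_⟩, ?_⟩
      · simp [κ.pt_zero]
      · simp
      · intro i hi j hj hij
        simp only [mem_Iic] at hi hj
        have hi' : i ≤ κ.n := by omega
        simp only [hi', if_true]
        split_ifs with hj'
        · exact κ.strictMonoOn (mem_Iic.2 hi') (mem_Iic.2 hj') hij
        · exact (κ.pt_mem hi').2.trans_lt (hb ▸ h)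
      · simp only [powSum]
        rw [Finset.sum_range_succ]
        congr 1
        · refine Finset.sum_congr rfl fun i hi => ?_
          have hi := Finset.mem_range.1 hi
          rw [if_pos (show i + 1 ≤ κ.n by omega), if_pos hi.le]
        · simp [κ.pt_last, hb]

/-- Putting `a` before and `b` after the trace gives a monotone chain from `a` to `b`, and the two
extra increments only increase the sum. -/
theorem BoundedPVariation.exists_powSum_trace_le {p : ℝ} (hp : p ≠ 0) {f : ℝ → ℝ}
    (hf : BoundedPVariation p a b f) :
    ∃ C, ∀ (κ : IntervalPartition a b) (u v : ℝ), a ≤ u → u ≤ v → v ≤ b →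
      powSum p f κ.n (κ.trace u v) ≤ C := by
  obtain ⟨C, hC⟩ := hf
  refine ⟨C, fun κ u v hu huv hv => ?_⟩
  set x : ℕ → ℝ := fun i => if i = 0 then a else if i ≤ κ.n + 1 then κ.trace u v (i - 1) else b
    with hx
  have hx1 : ∀ i ≤ κ.n, x (i + 1) = κ.trace u v i := fun i hi => by simp [hx, hi]
  have hxl : x (κ.n + 2) = b := by simp [hx]
  have hmono : ∀ i < κ.n + 2, x i ≤ x (i + 1) := by
    intro i hi
    rcases Nat.eq_zero_or_pos i with rfl | hpos
    · rw [hx1 0 (Nat.zero_le _)]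
      exact hu.trans (κ.trace_mem huv 0).1
    · obtain ⟨j, rfl⟩ : ∃ j, i = j + 1 := ⟨i - 1, by omega⟩
      rw [hx1 j (by omega)]
      rcases lt_or_eq_of_le (show j ≤ κ.n by omega) with h | h
      · rw [hx1 (j + 1) h]
        exact κ.trace_le_succ u v h
      · subst h
        rw [hxl]
        exact (κ.trace_mem huv _).2.trans hv
  obtain ⟨κ', hκ'⟩ := exists_intervalPartition_powSum_eq hp f x (κ.n + 2) hmono rfl hxl
  refine le_trans ?_ (hC ⟨κ', rfl⟩)
  change _ ≤ powSum p f κ'.n κ'.pt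
  rw [hκ']
  unfold powSum
  rw [Finset.sum_range_succ, Finset.sum_range_succ']
  have hnn : ∀ y : ℝ, 0 ≤ |y| ^ p := fun y => Real.rpow_nonneg (abs_nonneg y) p
  have he : ∑ i ∈ Finset.range κ.n, |f (κ.trace u v (i + 1)) - f (κ.trace u v i)| ^ p
      = ∑ i ∈ Finset.range κ.n, |f (x (i + 1 + 1)) - f (x (i + 1))| ^ p := by
    refine Finset.sum_congr rfl fun i hi => ?_
    have hi := Finset.mem_range.1 hi
    rw [hx1 i hi.le, hx1 (i + 1) hi]
  rw [he]
  linarith [hnn (f (x (0 + 1)) - f (x 0)), hnn (f (x (κ.n + 1 + 1)) - f (x (κ.n + 1)))]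

/-- A continuous function of bounded `p`-variation, `p < 2`, has quadratic variation zero. -/
theorem BoundedPVariation.hasLinearQuadVar_zero {p : ℝ} (hp : 0 < p) (hp2 : p < 2)
    (l : PartitionSeq a b) {f : ℝ → ℝ} (hf : BoundedPVariation p a b f)
    (hc : ContinuousOn f (Icc a b)) : HasLinearQuadVar l f 0 := by
  refine ⟨hc, fun u hu v hv huv => ?_⟩
  obtain ⟨C, hC⟩ := hf.exists_powSum_trace_le hp.ne'
  rw [zero_mul, Metric.tendsto_nhds]
  intro ε hε
  set η := ε / (2 * (|C| + 1)) with hη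
  have hηpos : 0 < η := by positivity
  -- The exponent makes `z² = |z|^(2-p) |z|^p ≤ η |z|^p` for each increment `z`.
  obtain ⟨δ, hδ, hδf⟩ := exists_abs_sub_lt_of_continuousOn hc
    (ε := η ^ (1 / (2 - p))) (by positivity)
  filter_upwards [l.eventually_trace_mesh_lt hδ u v] with m hm
  rw [Real.dist_eq, sub_zero, abs_of_nonneg (Finset.sum_nonneg fun i _ => sq_nonneg _)]
  have hsub : Icc u v ⊆ Icc a b := Icc_subset_Icc hu.1 hv.2
  have hle : germSum l (fun s t => (f t - f s) ^ 2) u v m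
      ≤ η * powSum p f (l.part m).n ((l.part m).trace u v) := by
    unfold germSum powSum
    rw [Finset.mul_sum]
    refine Finset.sum_le_sum fun i hi => ?_
    have hlt := hδf _ (hsub ((l.part m).trace_mem huv.le i)) _
      (hsub ((l.part m).trace_mem huv.le (i + 1))) (hm i (Finset.mem_range.1 hi))
    set z := f ((l.part m).trace u v (i + 1)) - f ((l.part m).trace u v i)
    have h1 : z ^ 2 = |z| ^ (2 - p) * |z| ^ p := by
      rw [← Real.rpow_add' (abs_nonneg z) (by norm_num), sub_add_cancel, Real.rpow_two, sq_abs]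
    change z ^ 2 ≤ _
    rw [h1]
    refine mul_le_mul_of_nonneg_right ?_ (by positivity)
    calc |z| ^ (2 - p) ≤ (η ^ (1 / (2 - p))) ^ (2 - p) :=
          Real.rpow_le_rpow (abs_nonneg z) hlt.le (by linarith)
      _ = η := by
          rw [← Real.rpow_mul hηpos.le, one_div_mul_cancel (by linarith), Real.rpow_one]
  calc germSum l (fun s t => (f t - f s) ^ 2) u v m
      ≤ η * powSum p f (l.part m).n ((l.part m).trace u v) := hle
    _ ≤ η * (|C| + 1) := by
        gcongr
        exact (hC _ u v hu.1 huv.le hv.2).trans (by linarith [le_abs_self C])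
    _ = ε / 2 := by rw [hη]; field_simp
    _ < ε := by linarith

/-- By Cauchy–Schwarz the mixed sum is at most the square root of the product of the two square
sums, which tends to zero. -/
theorem HasLinearQuadVar.add_zero {l : PartitionSeq a b} {g h : ℝ → ℝ} {κ : ℝ}
    (hg : HasLinearQuadVar l g κ) (hh : HasLinearQuadVar l h 0) :
    HasLinearQuadVar l (g + h) κ := by
  refine ⟨hg.continuousOn.add hh.continuousOn, fun u hu v hv huv => ?_⟩
  have h1 := hg.tendsto u hu v hv huv
  have h2 := hh.tendsto u hu v hv huv
  rw [zero_mul] at h2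
  have h3 : Tendsto (germSum l (fun s t => (g t - g s) * (h t - h s)) u v) atTop (𝓝 0) := by
    have hsq : Tendsto (fun m => √(germSum l (fun s t => (g t - g s) ^ 2) u v m
        * germSum l (fun s t => (h t - h s) ^ 2) u v m)) atTop (𝓝 0) := by
      have := (h1.mul h2).sqrt
      rwa [mul_zero, Real.sqrt_zero] at this
    refine squeeze_zero_norm (fun m => ?_) hsq
    rw [Real.norm_eq_abs]
    exact Real.abs_le_sqrt (Finset.sum_mul_sq_le_sq_mul_sq _ _ _)
  have h4 := h1.add ((h3.const_mul 2).add h2)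
  rw [mul_zero, _root_.add_zero, _root_.add_zero] at h4
  refine h4.congr fun m => ?_
  rw [← germSum_const_mul, ← germSum_add, ← germSum_add]
  unfold germSum
  refine Finset.sum_congr rfl fun i _ => ?_
  simp only [Pi.add_apply]
  ring

end PVariation

/-! ### Exponential prices -/

section Exponential

variable {T : ℝ}

/-- The class prescribes the `limUnder` value `bracket`, while `HasQuadVar` supplies some bracket
function `H`. Uniqueness of limits identifies the two, and `H` then controls all subintervals. -/
theorem hasLinearQuadVar_of_bracket {l : PartitionSeq 0 T} {g : ℝ → ℝ} {σ : ℝ}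
    (hg : g ∈ contQuadVarClass l σ) : HasLinearQuadVar l g (σ ^ 2) := by
  obtain ⟨hc, ⟨H, hH⟩, hb⟩ := hg
  have hval : ∀ t ∈ Icc 0 T, H t = σ ^ 2 * t := by
    intro t ht
    rcases ht.1.eq_or_lt with h | h
    · rw [← h, hH.bracket_left, mul_zero]
    · have h1 := hH.tendsto 0 ⟨le_rfl, ht.1.trans ht.2⟩ t ht h
      rw [hH.bracket_left, sub_zero] at h1
      rw [← hb t ht]
      exact h1.limUnder_eq.symm
  refine ⟨hc, fun u hu v hv huv => ?_⟩
  have h1 := hH.tendsto u hu v hv huv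
  simp_rw [powSum_two_eq_germSum] at h1
  rw [hval u hu, hval v hv, ← mul_sub] at h1
  exact h1

theorem HasLinearQuadVar.bracket_eq {l : PartitionSeq 0 T} {w : ℝ → ℝ} {κ : ℝ}
    (hw : HasLinearQuadVar l w κ) {t : ℝ} (ht : t ∈ Ioc 0 T) : bracket l w t = κ * t := by
  unfold bracket
  simp_rw [powSum_two_eq_germSum]
  have h := hw.tendsto 0 ⟨le_rfl, ht.1.le.trans ht.2⟩ t ⟨ht.1.le, ht.2⟩ ht.1
  rw [sub_zero] at h
  exact h.limUnder_eq

theorem HasLinearQuadVar.doleans_eq {l : PartitionSeq 0 T} {w : ℝ → ℝ} {κ : ℝ}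
    (hw : HasLinearQuadVar l w κ) (h0 : w 0 = 0) {t : ℝ} (ht : t ∈ Icc 0 T) :
    doleans l w t = Real.exp (w t - κ * t / 2) := by
  unfold doleans
  split_ifs with h
  · simp [h, h0]
  · have hpos : t ∈ Ioc 0 T := ⟨lt_of_le_of_ne ht.1 (Ne.symm h), ht.2⟩
    have hl : ∀ s : Ioc 0 t, leftJump 0 w s = 0 := fun s =>
      leftJump_eq_zero_of_continuousOn hw.continuousOn (s.2.2.trans ht.2)
    have hr : ∀ s : Ico 0 t, rightJump T w s = 0 := fun s =>
      rightJump_eq_zero_of_continuousOn hw.continuousOn s.2.1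
    simp [bracketCont, hl, hr, h0, hw.bracket_eq hpos]

/-- Subtraction of a linear drift. -/
theorem HasLinearQuadVar.sub_drift {l : PartitionSeq 0 T} {w : ℝ → ℝ} {κ : ℝ}
    (hw : HasLinearQuadVar l w κ) (hκ : 0 ≤ κ) (c : ℝ) :
    HasLinearQuadVar l (fun t => w t - c * t) κ := by
  have hc : ContinuousOn (fun t => w t - c * t) (Icc 0 T) := hw.continuousOn.sub (by fun_prop)
  refine ⟨hc, fun u hu v hv huv => ?_⟩
  have hsub : Icc u v ⊆ Icc 0 T := Icc_subset_Icc hu.1 hv.2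
  have h := tendsto_germSum_of_expansion l
    (G := fun s t => ((w t - c * t) - (w s - c * s)) ^ 2) (F := fun _ => 0) (p := fun _ => 0)
    (q := fun _ => 1) (y := w) hκ hu.1 huv.le hv.2 continuousOn_const continuousOn_const
    continuousOn_const (hw.continuousOn.mono hsub)
    (fun u' hu' v' hv' => hw.tendsto u' (hsub hu') v' (hsub hv')) (by
      intro ε hε
      have hC : 0 < 2 * |c| + c ^ 2 + 1 := by positivity
      obtain ⟨δ, hδ, h⟩ := exists_abs_sub_lt_of_continuousOn (hw.continuousOn.mono hsub)
        (ε := ε / (2 * |c| + c ^ 2 + 1)) (by positivity)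
      refine ⟨min δ (ε / (2 * |c| + c ^ 2 + 1)), by positivity, fun s hs t ht hst hlt => ?_⟩
      rw [lt_min_iff] at hlt
      have habs : |t - s| = t - s := abs_of_nonneg (by linarith)
      have e1 := h s hs t ht (by rw [habs]; exact hlt.1)
      have ht0 : 0 ≤ t - s := by linarith
      set e := ε / (2 * |c| + c ^ 2 + 1) with he
      have hCe : (2 * |c| + c ^ 2 + 1) * e = ε := by rw [he]; field_simp
      -- The drift changes the squared increment by `t - s` times a uniformly small factor.
      have heq : ((w t - c * t) - (w s - c * s)) ^ 2 - (0 - 0) - 0 * (t - s)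
          - 1 * (w t - w s) ^ 2 = (t - s) * (c ^ 2 * (t - s) - 2 * c * (w t - w s)) := by ring
      rw [heq, abs_mul, habs]
      have e2 : |c ^ 2 * (t - s) - 2 * c * (w t - w s)| ≤ ε := by
        calc |c ^ 2 * (t - s) - 2 * c * (w t - w s)|
            ≤ |c ^ 2 * (t - s)| + |2 * c * (w t - w s)| := abs_sub _ _
          _ = c ^ 2 * (t - s) + 2 * |c| * |w t - w s| := by
              rw [abs_mul, abs_mul, abs_mul, habs, abs_of_nonneg (sq_nonneg c), abs_two]
          _ ≤ c ^ 2 * e + 2 * |c| * e := by gcongr; exact hlt.2.le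
          _ ≤ ε := by rw [← hCe]; nlinarith [show 0 < e by positivity]
      nlinarith [sq_nonneg (w t - w s)])
  simpa [mul_comm] using h

/-- The cubic remainder is written as `|x| * x ^ 2` so that `|x|` provides the small factor in front
of the squared increment. -/
theorem abs_exp_sub_quadratic_le {x : ℝ} (hx : |x| ≤ 1) :
    |Real.exp x - 1 - x - x ^ 2 / 2| ≤ |x| * x ^ 2 := by
  have h := Real.exp_bound hx (n := 3) (by norm_num)
  simp only [Finset.sum_range_succ, Finset.sum_range_zero, Nat.factorial] at h
  norm_num at h
  have h3 : |x| ^ 3 = |x| * x ^ 2 := by rw [pow_succ' |x|, sq_abs]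
  rw [h3] at h
  have h4 : 0 ≤ |x| * x ^ 2 := by positivity
  refine le_trans (le_of_eq ?_) (h.trans (by nlinarith))
  congr 1
  ring

/-- For `f = e^y` the left Cauchy integral of `f⁻¹` with respect to `f` is `y + κ t / 2`. -/
theorem HasLinearQuadVar.tendsto_inv_integral {l : PartitionSeq 0 T} {y : ℝ → ℝ} {κ : ℝ}
    (hy : HasLinearQuadVar l y κ) (hκ : 0 ≤ κ) {f : ℝ → ℝ}
    (hf : ∀ t ∈ Icc 0 T, f t = Real.exp (y t)) {u v : ℝ} (hu : u ∈ Icc 0 T) (hv : v ∈ Icc 0 T)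
    (huv : u < v) :
    Tendsto (germSum l (fun s t => (f s)⁻¹ * (f t - f s)) u v) atTop
      (𝓝 (y v + κ * v / 2 - (y u + κ * u / 2))) := by
  have hsub : Icc u v ⊆ Icc 0 T := Icc_subset_Icc hu.1 hv.2
  -- With `x = y t - y s` the summand is `e^x - 1 = x + x²/2 + O(|x|³)`, whence `F = y`, `p = 0`, `q
  -- = 1/2`.
  have h := tendsto_germSum_of_expansion l
    (G := fun s t => (f s)⁻¹ * (f t - f s)) (F := y) (p := fun _ => 0)
    (q := fun _ => 1 / 2) (y := y) hκ hu.1 huv.le hv.2 (hy.continuousOn.mono hsub)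
    continuousOn_const continuousOn_const (hy.continuousOn.mono hsub)
    (fun u' hu' v' hv' => hy.tendsto u' (hsub hu') v' (hsub hv')) (by
      intro ε hε
      obtain ⟨δ, hδ, h⟩ := exists_abs_sub_lt_of_continuousOn (hy.continuousOn.mono hsub)
        (ε := min 1 ε) (by positivity)
      refine ⟨δ, hδ, fun s hs t ht hst hlt => ?_⟩
      have e1 := h s hs t ht (by rw [abs_of_nonneg (by linarith)]; exact hlt)
      rw [lt_min_iff] at e1
      have e2 := abs_exp_sub_quadratic_le e1.1.le
      have heq : (f s)⁻¹ * (f t - f s) = Real.exp (y t - y s) - 1 := by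
        rw [hf s (hsub hs), hf t (hsub ht), Real.exp_sub]
        field_simp
      rw [heq]
      have e3 : |y t - y s| * (y t - y s) ^ 2 ≤ ε * (y t - y s) ^ 2 :=
        mul_le_mul_of_nonneg_right e1.2.le (sq_nonneg _)
      have e4 : 0 ≤ ε * (t - s) := mul_nonneg hε.le (by linarith)
      refine le_trans (le_of_eq ?_) (e2.trans (by linarith))
      congr 1
      ring)
  convert h using 2
  simp
  ring

/-- For `f = e^y` the quadratic variation of `f` is `κ ∫ f²`. -/
theorem HasLinearQuadVar.tendsto_sq_exp {l : PartitionSeq 0 T} {y : ℝ → ℝ} {κ : ℝ}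
    (hy : HasLinearQuadVar l y κ) (hκ : 0 ≤ κ) {f : ℝ → ℝ}
    (hf : ∀ t ∈ Icc 0 T, f t = Real.exp (y t)) {u v : ℝ} (hu : u ∈ Icc 0 T) (hv : v ∈ Icc 0 T)
    (huv : u < v) :
    Tendsto (germSum l (fun s t => (f t - f s) ^ 2) u v) atTop
      (𝓝 (∫ t in u..v, κ * f t ^ 2)) := by
  have hsub : Icc u v ⊆ Icc 0 T := Icc_subset_Icc hu.1 hv.2
  have hyc := hy.continuousOn.mono hsub
  have hfc : ContinuousOn f (Icc u v) :=
    (Real.continuous_exp.comp_continuousOn hyc).congr fun t ht => hf t (hsub ht)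
  have h := tendsto_germSum_of_expansion l
    (G := fun s t => (f t - f s) ^ 2) (F := fun _ => 0) (p := fun _ => 0)
    (q := fun t => f t ^ 2) (y := y) hκ hu.1 huv.le hv.2 continuousOn_const
    continuousOn_const (hfc.pow 2) hyc
    (fun u' hu' v' hv' => hy.tendsto u' (hsub hu') v' (hsub hv')) (by
      intro ε hε
      obtain ⟨M, hM⟩ := isCompact_Icc.exists_bound_of_continuousOn (hfc.pow 2)
      obtain ⟨δ, hδ, h⟩ := exists_abs_sub_lt_of_continuousOn hyc
        (ε := min 1 (ε / (3 * (|M| + 1)))) (by positivity)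
      refine ⟨δ, hδ, fun s hs t ht hst hlt => ?_⟩
      have e1 := h s hs t ht (by rw [abs_of_nonneg (by linarith)]; exact hlt)
      rw [lt_min_iff] at e1
      have e2 := Real.abs_exp_sub_one_sub_id_le e1.1.le
      have hM' : f s ^ 2 ≤ |M| + 1 := by
        have := hM s hs
        rw [Real.norm_eq_abs, Pi.pow_apply, abs_of_nonneg (sq_nonneg _)] at this
        linarith [le_abs_self M]
      set x := y t - y s
      have hfx : f t - f s = f s * (Real.exp x - 1) := by
        rw [hf s (hsub hs), hf t (hsub ht), Real.exp_sub]
        field_simp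
      -- Difference of squares `(e^x - 1)² - x²`; its factors are at most `x²` and `3|x|`.
      have heq : (f t - f s) ^ 2 - (0 - 0) - 0 * (t - s) - f s ^ 2 * x ^ 2
          = f s ^ 2 * ((Real.exp x - 1 - x) * (Real.exp x - 1 - x + 2 * x)) := by
        rw [hfx]; ring
      rw [heq, abs_mul, abs_mul, abs_of_nonneg (sq_nonneg (f s))]
      have e3 : |Real.exp x - 1 - x + 2 * x| ≤ 3 * |x| := by
        refine (abs_add_le _ _).trans ?_
        rw [abs_mul, abs_two]
        have : x ^ 2 ≤ |x| := by rw [← sq_abs]; nlinarith [abs_nonneg x, e1.1]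
        linarith
      have hx0 := abs_nonneg x
      calc f s ^ 2 * (|Real.exp x - 1 - x| * |Real.exp x - 1 - x + 2 * x|)
          ≤ (|M| + 1) * (x ^ 2 * (3 * |x|)) := by gcongr
        _ ≤ (|M| + 1) * (x ^ 2 * (3 * (ε / (3 * (|M| + 1))))) := by gcongr; exact e1.2.le
        _ = ε * x ^ 2 := by field_simp
        _ ≤ ε * (t - s + x ^ 2) := by nlinarith)
  simpa using h

/-- The price set `{exp (w - κ t / 2) : w ∈ X}` is a stock of the evolutionary model. -/
theorem isStock_of_hasLinearQuadVar {l : PartitionSeq 0 T} (hT : 0 < T) {κ : ℝ} (hκ : 0 ≤ κ)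
    {P X : Set (ℝ → ℝ)} (hX : ∀ w ∈ X, HasLinearQuadVar l w κ ∧ w 0 = 0)
    (hPX : ∀ f ∈ P, ∃ w ∈ X, ∀ t ∈ Icc 0 T, f t = Real.exp (w t - κ * t / 2))
    (hXP : ∀ w ∈ X, ∃ f ∈ P, ∀ t ∈ Icc 0 T, f t = Real.exp (w t - κ * t / 2)) :
    IsStock l P := by
  have hy : ∀ w ∈ X, HasLinearQuadVar l (fun t => w t - κ * t / 2) κ := by
    intro w hw
    have := (hX w hw).1.sub_drift hκ (κ / 2)
    refine (funext fun t => ?_ : (fun t => w t - κ / 2 * t) = fun t => w t - κ * t / 2) ▸ this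
    ring
  have hcont : ∀ w ∈ X, ∀ f : ℝ → ℝ, (∀ t ∈ Icc 0 T, f t = Real.exp (w t - κ * t / 2)) →
      ContinuousOn f (Icc 0 T) := fun w hw f hf =>
    (Real.continuous_exp.comp_continuousOn (hy w hw).continuousOn).congr hf
  -- The Itô correction `κ t / 2` cancels the drift in the exponent, so the return of `f` is `w`
  -- itself.
  have hLC : ∀ w ∈ X, ∀ f : ℝ → ℝ, (∀ t ∈ Icc 0 T, f t = Real.exp (w t - κ * t / 2)) →
      IsLeftCauchyIntegral l (Icc 0 T) (fun t => (f t)⁻¹) f w := by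
    intro w hw f hf
    refine isLeftCauchyIntegral_of_continuousOn Subset.rfl (hcont w hw f hf)
      (hX w hw).1.continuousOn (hX w hw).2 fun u hu v hv huv => ?_
    convert ((hy w hw).tendsto_inv_integral hκ hf hu hv huv) using 2
    ring
  refine ⟨X, ?_, ?_, ?_, ?_⟩
  · intro f hfP
    obtain ⟨w, hw, hf⟩ := hPX f hfP
    have hfc := hcont w hw f hf
    have hint : ∀ u ∈ Icc 0 T, ∀ v ∈ Icc 0 T,
        IntervalIntegrable (fun t => κ * f t ^ 2) MeasureTheory.volume u v := by
      intro u hu v hv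
      refine ContinuousOn.intervalIntegrable ?_
      exact (continuousOn_const.mul (hfc.pow 2)).mono (uIcc_subset_Icc hu hv)
    have h0T : (0 : ℝ) ∈ Icc 0 T := ⟨le_rfl, hT.le⟩
    refine ⟨⟨fun t => ∫ s in (0 : ℝ)..t, κ * f s ^ 2, hasBracket_of_continuousOn hfc ?_ ?_ ?_⟩,
      ?_, ?_, ?_⟩
    · have := intervalIntegral.continuousOn_primitive_interval'
        (hint 0 h0T T ⟨hT.le, le_rfl⟩) left_mem_uIcc
      rwa [uIcc_of_le hT.le] at this
    · simp
    · intro u hu v hv huv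
      have := intervalIntegral.integral_add_adjacent_intervals (hint 0 h0T u hu) (hint u hu v hv)
      convert ((hy w hw).tendsto_sq_exp hκ hf hu hv huv) using 2
      linarith
    · simp [hf 0 h0T, (hX w hw).2]
    · obtain ⟨t₀, ht₀, hmin⟩ := isCompact_Icc.exists_isMinOn ⟨0, h0T⟩ hfc
      exact ⟨f t₀, by rw [hf t₀ ht₀]; exact Real.exp_pos _, fun t ht => hmin ht⟩
    · intro t ht hne
      exact absurd (rightJump_eq_zero_of_continuousOn hfc ht.1.le) hne
  · intro w hw
    have hwc := (hX w hw).1.continuousOn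
    refine ⟨⟨_, (hX w hw).1.hasBracket⟩, (hX w hw).2, ⟨1, one_pos, fun t ht => ?_⟩, ?_⟩
    · rw [leftJump_eq_zero_of_continuousOn hwc ht.2, rightJump_eq_zero_of_continuousOn hwc ht.1]
      simp
    · intro t ht hne
      exact absurd (rightJump_eq_zero_of_continuousOn hwc ht.1.le) hne
  · intro f hf
    obtain ⟨w, hw, h⟩ := hPX f hf
    exact ⟨w, hw, hLC w hw f h⟩
  · intro w hw
    obtain ⟨f, hf, h⟩ := hXP w hw
    exact ⟨f, hf, hLC w hw f h⟩

end Exponential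

/-! ### Taylor expansion, uniform on compact sets -/

section Taylor

theorem abs_image_sub_le_of_hasDerivAt {f f' : ℝ → ℝ} {C x y : ℝ}
    (hf : ∀ t ∈ uIcc x y, HasDerivAt f (f' t) t) (hb : ∀ t ∈ uIcc x y, |f' t| ≤ C) :
    |f y - f x| ≤ C * |y - x| :=
  Convex.norm_image_sub_le_of_norm_hasDerivWithin_le
    (fun t ht => (hf t ht).hasDerivWithinAt) hb (convex_uIcc x y) left_mem_uIcc right_mem_uIcc

/-- A function that is once differentiable in time and twice in space, with continuous highest
derivatives, has a second order expansion that is uniform on compact sets. -/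
theorem exists_taylor_expansion {F Ft Fx Fxx : ℝ → ℝ → ℝ} {c d M : ℝ}
    (hFt : ∀ t ∈ Icc c d, ∀ x, HasDerivAt (fun t => F t x) (Ft t x) t)
    (hFx : ∀ t ∈ Icc c d, ∀ x, HasDerivAt (F t) (Fx t x) x)
    (hFxx : ∀ t ∈ Icc c d, ∀ x, HasDerivAt (Fx t) (Fxx t x) x)
    (hct : ContinuousOn (fun z : ℝ × ℝ => Ft z.1 z.2) (Icc c d ×ˢ univ))
    (hcx : ContinuousOn (fun z : ℝ × ℝ => Fxx z.1 z.2) (Icc c d ×ˢ univ))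
    {ε : ℝ} (hε : 0 < ε) :
    ∃ δ > 0, ∀ s ∈ Icc c d, ∀ t ∈ Icc c d, ∀ x ∈ Icc (-M) M, ∀ z ∈ Icc (-M) M,
      |t - s| < δ → |z - x| < δ →
      |F t z - F s x - Ft s x * (t - s) - Fx s x * (z - x) - Fxx s x / 2 * (z - x) ^ 2|
        ≤ ε * (|t - s| + (z - x) ^ 2) := by
  have hsub : Icc c d ×ˢ Icc (-M) M ⊆ Icc c d ×ˢ (univ : Set ℝ) :=
    prod_mono_right (subset_univ _)
  have hK : IsCompact (Icc c d ×ˢ Icc (-M) M) := isCompact_Icc.prod isCompact_Icc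
  obtain ⟨δ₁, hδ₁, h₁⟩ := Metric.uniformContinuousOn_iff.1
    (hK.uniformContinuousOn_of_continuous (hct.mono hsub)) ε hε
  obtain ⟨δ₂, hδ₂, h₂⟩ := Metric.uniformContinuousOn_iff.1
    (hK.uniformContinuousOn_of_continuous (hcx.mono hsub)) ε hε
  refine ⟨min δ₁ δ₂, by positivity, fun s hs t ht x hx z hz hts hzx => ?_⟩
  have hts' := lt_min_iff.1 hts
  have hzx' := lt_min_iff.1 hzx
  -- The increment is split into a time step at the final position `z` and a space step at the
  -- initial time `s`. The mean value inequality is used once in time and twice in space.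
  have htime : |(F t z - Ft s x * t) - (F s z - Ft s x * s)| ≤ ε * |t - s| := by
    have hI : uIcc s t ⊆ Icc c d := uIcc_subset_Icc hs ht
    refine abs_image_sub_le_of_hasDerivAt (f := fun τ => F τ z - Ft s x * τ)
      (f' := fun τ => Ft τ z - Ft s x) (fun τ hτ => ?_) (fun τ hτ => ?_)
    · exact ((hFt τ (hI hτ) z).sub ((hasDerivAt_id τ).const_mul (Ft s x))).congr_deriv (by simp)
    · have := h₁ (τ, z) ⟨hI hτ, hz⟩ (s, x) ⟨hs, hx⟩ (by
        rw [Prod.dist_eq, max_lt_iff, Real.dist_eq, Real.dist_eq]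
        exact ⟨(abs_sub_left_of_mem_uIcc hτ).trans_lt hts'.1, hzx'.1⟩)
      exact this.le
  have hxI : uIcc x z ⊆ Icc (-M) M := uIcc_subset_Icc hx hz
  have hFx' : ∀ ξ ∈ uIcc x z, |Fx s ξ - Fx s x - Fxx s x * (ξ - x)| ≤ ε * |z - x| := by
    intro ξ hξ
    have hξI : uIcc x ξ ⊆ uIcc x z := uIcc_subset_uIcc_left hξ
    have h := abs_image_sub_le_of_hasDerivAt (x := x) (y := ξ)
      (f := fun η => Fx s η - Fxx s x * η)
      (f' := fun η => Fxx s η - Fxx s x) (C := ε) (fun η hη => by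
        exact ((hFxx s hs η).sub ((hasDerivAt_id η).const_mul (Fxx s x))).congr_deriv (by simp))
      (fun η hη => by
        have := h₂ (s, η) ⟨hs, hxI (hξI hη)⟩ (s, x) ⟨hs, hx⟩ (by
          rw [Prod.dist_eq, max_lt_iff, Real.dist_eq, Real.dist_eq]
          refine ⟨by simpa using hδ₂, ?_⟩
          exact (abs_sub_left_of_mem_uIcc (hξI hη)).trans_lt hzx'.2)
        exact this.le)
    have e : Fx s ξ - Fx s x - Fxx s x * (ξ - x)
        = (Fx s ξ - Fxx s x * ξ) - (Fx s x - Fxx s x * x) := by ring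
    rw [e]
    refine h.trans ?_
    exact mul_le_mul_of_nonneg_left (abs_sub_left_of_mem_uIcc hξ) hε.le
  have hspace : |(F s z - Fx s x * (z - x) - Fxx s x / 2 * (z - x) ^ 2)
      - (F s x - Fx s x * (x - x) - Fxx s x / 2 * (x - x) ^ 2)| ≤ ε * |z - x| * |z - x| := by
    refine abs_image_sub_le_of_hasDerivAt
      (f := fun ξ => F s ξ - Fx s x * (ξ - x) - Fxx s x / 2 * (ξ - x) ^ 2)
      (f' := fun ξ => Fx s ξ - Fx s x - Fxx s x * (ξ - x)) (fun ξ hξ => ?_) hFx'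
    have h1 := ((hasDerivAt_id ξ).sub_const x)
    have h2 := ((hFx s hs ξ).sub (h1.const_mul (Fx s x))).sub
      ((h1.pow 2).const_mul (Fxx s x / 2))
    refine h2.congr_deriv ?_
    simp
    ring
  have hsq : |z - x| * |z - x| = (z - x) ^ 2 := by rw [← sq, sq_abs]
  rw [mul_assoc, hsq] at hspace
  have e : F t z - F s x - Ft s x * (t - s) - Fx s x * (z - x) - Fxx s x / 2 * (z - x) ^ 2
      = ((F t z - Ft s x * t) - (F s z - Ft s x * s))
        + ((F s z - Fx s x * (z - x) - Fxx s x / 2 * (z - x) ^ 2)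
          - (F s x - Fx s x * (x - x) - Fxx s x / 2 * (x - x) ^ 2)) := by ring
  rw [e]
  refine (abs_add_le _ _).trans ?_
  linarith

/-- The Itô formula for the left Cauchy integral of `e^{-y} ∂ₓF(t,y)` with respect to `e^y`. -/
theorem tendsto_germSum_exp_of_hasDerivAt {T : ℝ} {l : PartitionSeq 0 T} {y : ℝ → ℝ} {κ : ℝ}
    (hy : HasLinearQuadVar l y κ) (hκ : 0 ≤ κ) {F Ft Fx Fxx : ℝ → ℝ → ℝ} {c d : ℝ}
    (hc : 0 ≤ c) (hcd : c ≤ d) (hd : d ≤ T)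
    (hFt : ∀ t ∈ Icc c d, ∀ x, HasDerivAt (fun t => F t x) (Ft t x) t)
    (hFx : ∀ t ∈ Icc c d, ∀ x, HasDerivAt (F t) (Fx t x) x)
    (hFxx : ∀ t ∈ Icc c d, ∀ x, HasDerivAt (Fx t) (Fxx t x) x)
    (hcF : ContinuousOn (fun z : ℝ × ℝ => F z.1 z.2) (Icc c d ×ˢ univ))
    (hct : ContinuousOn (fun z : ℝ × ℝ => Ft z.1 z.2) (Icc c d ×ˢ univ))
    (hcx : ContinuousOn (fun z : ℝ × ℝ => Fx z.1 z.2) (Icc c d ×ˢ univ))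
    (hcxx : ContinuousOn (fun z : ℝ × ℝ => Fxx z.1 z.2) (Icc c d ×ˢ univ))
    {φ f : ℝ → ℝ} (hf : ∀ t ∈ Icc 0 T, f t = Real.exp (y t))
    (hφ : ∀ t ∈ Icc c d, φ t * Real.exp (y t) = Fx t (y t)) :
    Tendsto (germSum l (fun s t => φ s * (f t - f s)) c d) atTop
      (𝓝 (F d (y d) - F c (y c)
        - ∫ t in c..d, (Ft t (y t) + κ / 2 * (Fxx t (y t) - Fx t (y t))))) := by
  have hsub : Icc c d ⊆ Icc 0 T := Icc_subset_Icc hc hd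
  have hyc := hy.continuousOn.mono hsub
  have hpair : ContinuousOn (fun t => (t, y t)) (Icc c d) := continuousOn_id.prodMk hyc
  have hcomp : ∀ H : ℝ → ℝ → ℝ, ContinuousOn (fun z : ℝ × ℝ => H z.1 z.2) (Icc c d ×ˢ univ) →
      ContinuousOn (fun t => H t (y t)) (Icc c d) := fun H hH =>
    hH.comp hpair fun t ht => ⟨ht, mem_univ _⟩
  obtain ⟨M, hM⟩ := isCompact_Icc.exists_bound_of_continuousOn hyc
  have hyM : ∀ t ∈ Icc c d, y t ∈ Icc (-M) M := fun t ht => abs_le.1 (hM t ht)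
  obtain ⟨B, hB⟩ := isCompact_Icc.exists_bound_of_continuousOn (hcomp Fx hcx)
  -- The summand is `F_x (e^x - 1) = F_x x + F_x x²/2 + …` with `x = y t - y s`. Taylor's formula
  -- replaces `F_x x` by `ΔF - F_t (t - s) - F_xx x²/2`, which gives `p` and `q`.
  have h := tendsto_germSum_of_expansion l
    (G := fun s t => φ s * (f t - f s)) (F := fun t => F t (y t)) (p := fun t => - Ft t (y t))
    (q := fun t => (Fx t (y t) - Fxx t (y t)) / 2) (y := y) hκ hc hcd hd (hcomp F hcF)
    (hcomp Ft hct).neg (((hcomp Fx hcx).sub (hcomp Fxx hcxx)).div_const 2) hyc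
    (fun u' hu' v' hv' => hy.tendsto u' (hsub hu') v' (hsub hv')) (by
      intro ε hε
      obtain ⟨δ₁, hδ₁, h₁⟩ := exists_taylor_expansion (M := M) hFt hFx hFxx hct hcxx
        (ε := ε / 2) (by positivity)
      obtain ⟨δ₂, hδ₂, h₂⟩ := exists_abs_sub_lt_of_continuousOn hyc
        (ε := min δ₁ (min 1 (ε / (2 * (|B| + 1))))) (by positivity)
      refine ⟨min δ₁ δ₂, by positivity, fun s hs t ht hst hlt => ?_⟩
      rw [lt_min_iff] at hlt
      have habs : |t - s| = t - s := abs_of_nonneg (by linarith)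
      have e1 := h₂ s hs t ht (by rw [habs]; exact hlt.2)
      simp only [lt_min_iff] at e1
      have e2 := h₁ s hs t ht (y s) (hyM s hs) (y t) (hyM t ht) (by rw [habs]; exact hlt.1) e1.1
      have e3 := abs_exp_sub_quadratic_le e1.2.1.le
      rw [habs] at e2
      set x := y t - y s
      have heq : φ s * (f t - f s) = Fx s (y s) * (Real.exp x - 1) := by
        rw [← hφ s hs, hf s (hsub hs), hf t (hsub ht), Real.exp_sub]
        field_simp
      have hBs : |Fx s (y s)| ≤ |B| + 1 := (hB s hs).trans (by linarith [le_abs_self B])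
      have e4 : |Fx s (y s) * (Real.exp x - 1 - x - x ^ 2 / 2)| ≤ ε / 2 * x ^ 2 := by
        rw [abs_mul]
        calc |Fx s (y s)| * |Real.exp x - 1 - x - x ^ 2 / 2|
            ≤ (|B| + 1) * (|x| * x ^ 2) := by gcongr
          _ ≤ (|B| + 1) * (ε / (2 * (|B| + 1)) * x ^ 2) := by gcongr; exact e1.2.2.le
          _ = ε / 2 * x ^ 2 := by field_simp
      rw [heq]
      have hts : 0 ≤ ε / 2 * (t - s) := mul_nonneg (by positivity) (by linarith)
      rw [abs_le] at e2 e4 ⊢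
      constructor <;> linarith [e2.1, e2.2, e4.1, e4.2])
  convert h using 2
  rw [sub_eq_add_neg, ← intervalIntegral.integral_neg]
  congr 1
  refine intervalIntegral.integral_congr fun t _ => ?_
  ring

end Taylor

/-! ### The Black–Scholes function in logarithmic price -/

section BlackScholes

open ProbabilityTheory

theorem hasDerivAt_stdNormalCDF (x : ℝ) :
    HasDerivAt stdNormalCDF (gaussianPDFReal 0 1 x) x := by
  have hcont : Continuous (gaussianPDFReal 0 1) := by unfold gaussianPDFReal; fun_prop
  have hint := integrable_gaussianPDFReal 0 1
  have h : ∀ z, stdNormalCDF z = stdNormalCDF 0 + ∫ t in (0 : ℝ)..z, gaussianPDFReal 0 1 t := by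
    have hv : ∀ z, stdNormalCDF z = ∫ t in Iic z, gaussianPDFReal 0 1 t := by
      intro z
      unfold stdNormalCDF
      rw [cdf_eq_real, MeasureTheory.measureReal_def, gaussianReal_apply_eq_integral 0 one_ne_zero,
        ENNReal.toReal_ofReal]
      exact MeasureTheory.integral_nonneg fun t => gaussianPDFReal_nonneg 0 1 t
    intro z
    rw [hv, hv, ← intervalIntegral.integral_Iic_sub_Iic hint.integrableOn hint.integrableOn]
    ring
  rw [show stdNormalCDF = fun z => stdNormalCDF 0 + ∫ t in (0 : ℝ)..z, gaussianPDFReal 0 1 t from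
    funext h]
  exact (intervalIntegral.integral_hasDerivAt_right (hcont.intervalIntegrable _ _)
    (hcont.stronglyMeasurableAtFilter _ _) hcont.continuousAt).const_add _

theorem continuous_stdNormalCDF : Continuous stdNormalCDF :=
  continuous_iff_continuousAt.2 fun x => (hasDerivAt_stdNormalCDF x).continuousAt

theorem continuous_gaussianPDFReal : Continuous (gaussianPDFReal 0 1) := by
  unfold gaussianPDFReal; fun_prop

theorem abs_stdNormalCDF_le_one (x : ℝ) : |stdNormalCDF x| ≤ 1 := by
  unfold stdNormalCDF
  rw [abs_of_nonneg (cdf_nonneg _ x)]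
  exact cdf_le_one _ x

variable (σ r K T : ℝ)

/-- `d₁(t, e^x)`. -/
def logD₁ (t x : ℝ) : ℝ := (x - Real.log K + (r + σ ^ 2 / 2) * (T - t)) / (σ * √(T - t))

/-- `d₂(t, e^x)`. -/
def logD₂ (t x : ℝ) : ℝ := logD₁ σ r K T t x - σ * √(T - t)

/-- The value of the bond part of the hedge at the price `e^x`, with the opposite sign. -/
def bondPart (t x : ℝ) : ℝ := K * Real.exp (-r * (T - t)) * stdNormalCDF (logD₂ σ r K T t x)

/-- The value of the stock part of the hedge at the price `e^x`. -/
def stockPart (t x : ℝ) : ℝ := Real.exp x * stdNormalCDF (logD₁ σ r K T t x)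

/-- The Black–Scholes value `φ(t, e^x)`, for `t < T`. -/
def logCallValue (t x : ℝ) : ℝ := stockPart σ r K T t x - bondPart σ r K T t x

/-- The scaled density `e^x n(d₁(t, e^x))`. -/
def stockDensity (t x : ℝ) : ℝ := Real.exp x * gaussianPDFReal 0 1 (logD₁ σ r K T t x)

variable {σ r K T}

theorem d₁_exp (hK : 0 < K) (t x : ℝ) : d₁ σ r K T t (Real.exp x) = logD₁ σ r K T t x := by
  unfold d₁ logD₁
  rw [Real.log_div (Real.exp_pos x).ne' hK.ne', Real.log_exp]

/-- Completing the square: `d₂² = d₁² - 2 d₁ σ√(T-t) + σ²(T-t)`, and `d₁ σ√(T-t)` is the numerator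
of `d₁`. The identity cancels density terms in the derivatives of the option value. -/
theorem bondDensity_eq_stockDensity (hσ : 0 < σ) (hK : 0 < K) {t : ℝ} (ht : t < T) (x : ℝ) :
    K * Real.exp (-r * (T - t)) * gaussianPDFReal 0 1 (logD₂ σ r K T t x)
      = stockDensity σ r K T t x := by
  have hτ : 0 < T - t := sub_pos.2 ht
  have hs : 0 < √(T - t) := Real.sqrt_pos.2 hτ
  have hss : √(T - t) * √(T - t) = T - t := Real.mul_self_sqrt hτ.le
  have hD : logD₁ σ r K T t x * (σ * √(T - t))
      = x - Real.log K + (r + σ ^ 2 / 2) * (T - t) := by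
    unfold logD₁; field_simp
  unfold stockDensity logD₂ gaussianPDFReal
  set D := logD₁ σ r K T t x
  have hexp : Real.exp (Real.log K + -r * (T - t) + -(D - σ * √(T - t) - 0) ^ 2 / (2 * 1))
      = Real.exp (x + -(D - 0) ^ 2 / (2 * 1)) := by
    congr 1
    have : (D - σ * √(T - t)) ^ 2
        = D ^ 2 - 2 * (D * (σ * √(T - t))) + σ ^ 2 * (√(T - t) * √(T - t)) := by ring
    rw [sub_zero, this, hD, hss]
    ring
  rw [Real.exp_add, Real.exp_add, Real.exp_log hK, Real.exp_add] at hexp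
  simp only [NNReal.coe_one]
  linear_combination (√(2 * Real.pi * 1))⁻¹ * hexp

theorem hasDerivAt_logD₁ (t x : ℝ) :
    HasDerivAt (logD₁ σ r K T t) (1 / (σ * √(T - t))) x := by
  unfold logD₁
  exact (((hasDerivAt_id x).sub_const _).add_const _).div_const _

theorem hasDerivAt_stockPart (t x : ℝ) :
    HasDerivAt (stockPart σ r K T t)
      (stockPart σ r K T t x + stockDensity σ r K T t x / (σ * √(T - t))) x := by
  have h := (Real.hasDerivAt_exp x).mul
    ((hasDerivAt_stdNormalCDF _).comp x (hasDerivAt_logD₁ (σ := σ) (r := r) (K := K) (T := T) t x))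
  refine h.congr_deriv ?_
  unfold stockPart stockDensity
  simp only [Function.comp_apply]
  ring

/-- `d₁` and `d₂` have the same space derivative, so the two density terms cancel and the price
times the hedge ratio remains. -/
theorem hasDerivAt_logCallValue (hσ : 0 < σ) (hK : 0 < K) {t : ℝ} (ht : t < T) (x : ℝ) :
    HasDerivAt (logCallValue σ r K T t) (stockPart σ r K T t x) x := by
  have h2 := ((hasDerivAt_stdNormalCDF _).comp x
    ((hasDerivAt_logD₁ (σ := σ) (r := r) (K := K) (T := T) t x).sub_const
      (σ * √(T - t)))).const_mul (K * Real.exp (-r * (T - t)))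
  have h := (hasDerivAt_stockPart (σ := σ) (r := r) (K := K) (T := T) t x).sub h2
  refine h.congr_deriv ?_
  have := bondDensity_eq_stockDensity (r := r) hσ hK ht x
  unfold logD₂ at this
  rw [← mul_assoc, this]
  ring

theorem hasDerivAt_logCallValue_time (hσ : 0 < σ) (hK : 0 < K) {t : ℝ} (ht : t < T) (x : ℝ) :
    HasDerivAt (fun t => logCallValue σ r K T t x)
      (-(stockDensity σ r K T t x * (σ / (2 * √(T - t)))) - r * bondPart σ r K T t x) t := by
  have hτ : 0 < T - t := sub_pos.2 ht
  have hs : 0 < √(T - t) := Real.sqrt_pos.2 hτ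
  have hlin : HasDerivAt (fun t => T - t) (-1) t := by
    simpa using (hasDerivAt_id t).const_sub T
  have hsqrt : HasDerivAt (fun t => σ * √(T - t)) (σ * (-1 / (2 * √(T - t)))) t :=
    (hlin.sqrt hτ.ne').const_mul σ
  -- The value `e` is never needed: it enters through `d₁` and `d₂` alike and cancels, leaving only
  -- the derivative of `σ√(T-t)`.
  have hD : ∃ e, HasDerivAt (fun t => logD₁ σ r K T t x) e t :=
    ⟨_, ((hlin.const_mul (r + σ ^ 2 / 2)).const_add (x - Real.log K)).div hsqrt
      (by positivity)⟩
  obtain ⟨e, he⟩ := hD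
  have h1 := ((hasDerivAt_stdNormalCDF _).comp t he).const_mul (Real.exp x)
  have h2 := ((hlin.const_mul (-r)).exp.const_mul K).mul
    ((hasDerivAt_stdNormalCDF _).comp t (he.sub hsqrt))
  have h := h1.sub h2
  refine h.congr_deriv ?_
  have := bondDensity_eq_stockDensity (r := r) hσ hK ht x
  unfold logD₂ at this
  unfold bondPart logD₂
  unfold stockDensity at this ⊢
  simp only [Function.comp_apply, Pi.sub_apply]
  linear_combination -(e + σ / (2 * √(T - t))) * this

variable {d : ℝ}

theorem continuousOn_logD₁ (hσ : 0 < σ) (hd : d < T) :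
    ContinuousOn (fun z : ℝ × ℝ => logD₁ σ r K T z.1 z.2) (Icc 0 d ×ˢ univ) := by
  unfold logD₁
  refine ContinuousOn.div (by fun_prop) (by fun_prop) fun z hz => ?_
  have : 0 < T - z.1 := by linarith [hz.1.2]
  positivity

theorem continuousOn_stockPart (hσ : 0 < σ) (hd : d < T) :
    ContinuousOn (fun z : ℝ × ℝ => stockPart σ r K T z.1 z.2) (Icc 0 d ×ˢ univ) :=
  ContinuousOn.mul (by fun_prop)
    (continuous_stdNormalCDF.comp_continuousOn (continuousOn_logD₁ hσ hd))

theorem continuousOn_stockDensity (hσ : 0 < σ) (hd : d < T) :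
    ContinuousOn (fun z : ℝ × ℝ => stockDensity σ r K T z.1 z.2) (Icc 0 d ×ˢ univ) :=
  ContinuousOn.mul (by fun_prop)
    (continuous_gaussianPDFReal.comp_continuousOn (continuousOn_logD₁ hσ hd))

theorem continuousOn_bondPart (hσ : 0 < σ) (hd : d < T) :
    ContinuousOn (fun z : ℝ × ℝ => bondPart σ r K T z.1 z.2) (Icc 0 d ×ˢ univ) :=
  ContinuousOn.mul (by fun_prop)
    (continuous_stdNormalCDF.comp_continuousOn ((continuousOn_logD₁ hσ hd).sub (by fun_prop)))

/-- Uniformity up to maturity is what makes the gain integrals converge at `T`. -/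
theorem abs_bondPart_le (hr : 0 < r) (hK : 0 < K) {t : ℝ} (ht : t ≤ T) (x : ℝ) :
    |bondPart σ r K T t x| ≤ K := by
  unfold bondPart
  have h : Real.exp (-r * (T - t)) ≤ 1 := Real.exp_le_one_iff.2 (by nlinarith)
  rw [abs_mul, abs_mul, abs_of_pos hK, abs_of_pos (Real.exp_pos _)]
  calc K * Real.exp (-r * (T - t)) * |stdNormalCDF (logD₂ σ r K T t x)| ≤ K * 1 * 1 := by
        gcongr
        exact abs_stdNormalCDF_le_one _
    _ = K := by ring

/-- The gain of the stock part of the hedge on an interval before maturity. -/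
theorem tendsto_stock_gain {l : PartitionSeq 0 T} {y : ℝ → ℝ} (hσ : 0 < σ) (hK : 0 < K)
    (hy : HasLinearQuadVar l y (σ ^ 2)) {P : ℝ → ℝ} (hP : ∀ t ∈ Icc 0 T, P t = Real.exp (y t))
    {u v : ℝ} (hu : 0 ≤ u) (huv : u ≤ v) (hv : v < T) :
    Tendsto (germSum l (fun s t => hedgeStock σ r K T P s * (P t - P s)) u v) atTop
      (𝓝 (logCallValue σ r K T v (y v) - logCallValue σ r K T u (y u)
        + ∫ t in u..v, r * bondPart σ r K T t (y t))) := by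
  have hsub : Icc u v ×ˢ (univ : Set ℝ) ⊆ Icc 0 v ×ˢ univ :=
    prod_mono_left (Icc_subset_Icc hu le_rfl)
  have hlt : ∀ t ∈ Icc u v, t < T := fun t ht => ht.2.trans_lt hv
  have hS := continuousOn_stockPart (r := r) (K := K) hσ hv
  have hN := continuousOn_stockDensity (r := r) (K := K) hσ hv
  have hB := continuousOn_bondPart (r := r) (K := K) hσ hv
  have hne : ∀ z ∈ Icc 0 v ×ˢ (univ : Set ℝ), 0 < √(T - z.1) := fun z hz =>
    Real.sqrt_pos.2 (by linarith [hz.1.2])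
  have h := tendsto_germSum_exp_of_hasDerivAt hy (sq_nonneg σ)
    (F := logCallValue σ r K T)
    (Ft := fun t x =>
      -(stockDensity σ r K T t x * (σ / (2 * √(T - t)))) - r * bondPart σ r K T t x)
    (Fx := stockPart σ r K T)
    (Fxx := fun t x => stockPart σ r K T t x + stockDensity σ r K T t x / (σ * √(T - t)))
    hu huv hv.le (fun t ht x => hasDerivAt_logCallValue_time hσ hK (hlt t ht) x)
    (fun t ht x => hasDerivAt_logCallValue hσ hK (hlt t ht) x)
    (fun t ht x => hasDerivAt_stockPart t x)
    ((hS.sub hB).mono hsub)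
    (ContinuousOn.mono (((hN.mul (ContinuousOn.div (by fun_prop) (by fun_prop) fun z hz =>
      (mul_pos two_pos (hne z hz)).ne')).neg).sub (continuousOn_const.mul hB)) hsub)
    (hS.mono hsub)
    (ContinuousOn.mono (hS.add (hN.div (by fun_prop) fun z hz =>
      (mul_pos hσ (hne z hz)).ne')) hsub)
    (φ := hedgeStock σ r K T P) hP (fun t ht => by
      unfold hedgeStock stockPart
      rw [if_pos (hlt t ht), hP t ⟨hu.trans ht.1, (hlt t ht).le⟩, d₁_exp hK, mul_comm])
  convert h using 2
  -- What remains is the Black–Scholes equation in the log price: the density terms of `F_t` and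
  -- `σ²/2 (F_xx - F_x)` cancel.
  rw [sub_eq_add_neg (logCallValue σ r K T v (y v) - _), ← intervalIntegral.integral_neg]
  congr 1
  refine intervalIntegral.integral_congr fun t ht => ?_
  rw [uIcc_of_le huv] at ht
  have hs : 0 < √(T - t) := Real.sqrt_pos.2 (sub_pos.2 (hlt t ht))
  field_simp
  ring

/-- The gain of the bond part of the hedge on an interval before maturity. -/
theorem tendsto_bond_gain {l : PartitionSeq 0 T} {y : ℝ → ℝ} (hσ : 0 < σ) (hr : 0 < r)
    (hK : 0 < K) (hyc : ContinuousOn y (Icc 0 T)) {P : ℝ → ℝ}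
    (hP : ∀ t ∈ Icc 0 T, P t = Real.exp (y t)) {u v : ℝ} (hu : 0 ≤ u) (huv : u ≤ v) (hv : v < T) :
    Tendsto (germSum l (fun s t => hedgeBond σ r K T (bond r) P s * (bond r t - bond r s)) u v)
      atTop (𝓝 (-∫ t in u..v, r * bondPart σ r K T t (y t))) := by
  have hsub : Icc u v ⊆ Icc 0 T := Icc_subset_Icc hu hv.le
  have hcB : ContinuousOn (fun t => bondPart σ r K T t (y t)) (Icc u v) :=
    (continuousOn_bondPart (r := r) (K := K) hσ hv).comp
      (continuousOn_id.prodMk (hyc.mono hsub)) fun t ht => ⟨⟨hu.trans ht.1, ht.2⟩, mem_univ _⟩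
  -- The bond is smooth, so no quadratic variation enters: the zero path serves as `y`. The bond
  -- position is worth `-bondPart` and grows at rate `r`, whence `p`.
  have h := tendsto_germSum_of_expansion l (κ := 0) (y := fun _ => 0) (F := fun _ => 0)
    (G := fun s t => hedgeBond σ r K T (bond r) P s * (bond r t - bond r s))
    (p := fun t => -(r * bondPart σ r K T t (y t))) (q := fun _ => 0) le_rfl hu huv hv.le
    continuousOn_const (continuousOn_const.mul hcB).neg continuousOn_const continuousOn_const
    (fun u' _ v' _ _ => by
      rw [zero_mul]
      exact tendsto_const_nhds.congr fun m => by simp [germSum]) (by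
      intro ε hε
      refine ⟨min (1 / r) (ε / (K * r ^ 2)), by positivity, fun s hs t ht hst hlt => ?_⟩
      rw [lt_min_iff] at hlt
      have hts : 0 ≤ t - s := by linarith
      have hr0 : 0 ≤ r * (t - s) := mul_nonneg hr.le hts
      have hr1 : |r * (t - s)| ≤ 1 := by
        rw [abs_of_nonneg hr0]
        have := hlt.1.le
        rw [le_div_iff₀ hr] at this
        linarith
      have e1 := Real.abs_exp_sub_one_sub_id_le hr1
      have hα : hedgeBond σ r K T (bond r) P s * bond r s = -bondPart σ r K T s (y s) := by
        have hsT : s < T := hs.2.trans_lt hv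
        unfold hedgeBond
        rw [div_mul_cancel₀ _ (by unfold bond; positivity)]
        unfold callValue hedgeStock
        rw [hP s (hsub hs), if_pos (Real.exp_pos _), if_pos hsT, if_pos hsT]
        unfold d₂ bondPart logD₂
        rw [d₁_exp hK]
        ring
      have hb : bond r t - bond r s = bond r s * (Real.exp (r * (t - s)) - 1) := by
        unfold bond
        rw [mul_sub, mul_sub, Real.exp_sub]
        field_simp
      rw [hb, ← mul_assoc, hα]
      have heq : -bondPart σ r K T s (y s) * (Real.exp (r * (t - s)) - 1) - (0 - 0)
          - -(r * bondPart σ r K T s (y s)) * (t - s) - 0 * (0 - 0) ^ 2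
          = -bondPart σ r K T s (y s) * (Real.exp (r * (t - s)) - 1 - r * (t - s)) := by ring
      rw [heq, abs_mul, abs_neg]
      have hlt2 := hlt.2.le
      rw [le_div_iff₀ (by positivity)] at hlt2
      calc |bondPart σ r K T s (y s)| * |Real.exp (r * (t - s)) - 1 - r * (t - s)|
          ≤ K * (r * (t - s)) ^ 2 := by
            gcongr
            exact abs_bondPart_le hr hK (hs.2.trans hv.le) _
        _ = (t - s) * (K * r ^ 2) * (t - s) := by ring
        _ ≤ ε * (t - s) := by gcongr
        _ = ε * (t - s + (0 - 0) ^ 2) := by ring)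
  simpa using h

/-- The Black–Scholes value along a continuous path converges to the pay-off at maturity. -/
theorem tendsto_logCallValue (hσ : 0 < σ) (hK : 0 < K) {y : ℝ → ℝ} {y₀ : ℝ}
    (hy : Tendsto y (𝓝[<] T) (𝓝 y₀)) :
    Tendsto (fun t => logCallValue σ r K T t (y t)) (𝓝[<] T)
      (𝓝 (max 0 (Real.exp y₀ - K))) := by
  have hid : Tendsto (fun t : ℝ => T - t) (𝓝[<] T) (𝓝 0) := by
    have : Tendsto (fun t : ℝ => T - t) (𝓝 T) (𝓝 (T - T)) := by
      exact (continuous_const.sub continuous_id).tendsto T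
    rw [sub_self] at this
    exact this.mono_left nhdsWithin_le_nhds
  have hs : Tendsto (fun t : ℝ => σ * √(T - t)) (𝓝[<] T) (𝓝 0) := by
    have := (hid.sqrt).const_mul σ
    rwa [Real.sqrt_zero, mul_zero] at this
  have hspos : ∀ᶠ t in 𝓝[<] T, 0 < σ * √(T - t) := by
    filter_upwards [self_mem_nhdsWithin] with t ht
    exact mul_pos hσ (Real.sqrt_pos.2 (sub_pos.2 ht))
  have hsinv : Tendsto (fun t : ℝ => (σ * √(T - t))⁻¹) (𝓝[<] T) atTop :=
    tendsto_inv_nhdsGT_zero.comp (tendsto_nhdsWithin_iff.2 ⟨hs, hspos⟩)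
  have hnum : Tendsto (fun t => y t - Real.log K + (r + σ ^ 2 / 2) * (T - t)) (𝓝[<] T)
      (𝓝 (y₀ - Real.log K)) := by
    have := (hy.sub_const (Real.log K)).add (hid.const_mul (r + σ ^ 2 / 2))
    rwa [mul_zero, add_zero] at this
  have hdisc : Tendsto (fun t => K * Real.exp (-r * (T - t))) (𝓝[<] T) (𝓝 K) := by
    have := ((hid.const_mul (-r)).rexp).const_mul K
    rwa [mul_zero, Real.exp_zero, mul_one] at this
  -- The value is written as `(e^y - K e^{-r(T-t)}) N(d₁)` plus this term, which vanishes because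
  -- `N` is Lipschitz and `d₁ - d₂ = σ√(T-t)`.
  have hdiff : Tendsto (fun t => K * Real.exp (-r * (T - t)) *
      (stdNormalCDF (logD₁ σ r K T t (y t)) - stdNormalCDF (logD₂ σ r K T t (y t))))
      (𝓝[<] T) (𝓝 0) := by
    have hz : Tendsto (fun t => stdNormalCDF (logD₁ σ r K T t (y t))
        - stdNormalCDF (logD₂ σ r K T t (y t))) (𝓝[<] T) (𝓝 0) := by
      have hC := hs.const_mul (√(2 * Real.pi))⁻¹
      rw [mul_zero] at hC
      refine squeeze_zero_norm' ?_ hC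
      filter_upwards [hspos] with t ht
      refine (abs_image_sub_le_of_hasDerivAt (fun x _ => hasDerivAt_stdNormalCDF x)
        (C := (√(2 * Real.pi))⁻¹) fun x _ => ?_).trans (le_of_eq ?_)
      · rw [abs_of_nonneg (gaussianPDFReal_nonneg 0 1 x)]
        unfold gaussianPDFReal
        simp only [NNReal.coe_one, mul_one]
        refine mul_le_of_le_one_right (by positivity) (Real.exp_le_one_iff.2 ?_)
        have := sq_nonneg (x - 0)
        linarith
      · unfold logD₂
        rw [sub_sub_cancel, abs_of_pos ht]
    simpa using hdisc.mul hz
  have hmain : Tendsto (fun t => (Real.exp (y t) - K * Real.exp (-r * (T - t)))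
      * stdNormalCDF (logD₁ σ r K T t (y t))) (𝓝[<] T) (𝓝 (max 0 (Real.exp y₀ - K))) := by
    have hfac : Tendsto (fun t => Real.exp (y t) - K * Real.exp (-r * (T - t))) (𝓝[<] T)
        (𝓝 (Real.exp y₀ - K)) := hy.rexp.sub hdisc
    rcases lt_trichotomy (Real.exp y₀) K with h | h | h
    · have hneg : y₀ - Real.log K < 0 := sub_neg.2 ((Real.lt_log_iff_exp_lt hK).2 h)
      have hD : Tendsto (fun t => logD₁ σ r K T t (y t)) (𝓝[<] T) atBot :=
        hnum.neg_mul_atTop hneg hsinv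
      have hcdf : Tendsto (fun t => stdNormalCDF (logD₁ σ r K T t (y t))) (𝓝[<] T) (𝓝 0) :=
        (tendsto_cdf_atBot _).comp hD
      have := hfac.mul hcdf
      rwa [mul_zero, ← max_eq_left (show Real.exp y₀ - K ≤ 0 by linarith)] at this
    -- At the money `N(d₁)` need not converge, but it is bounded and its prefactor tends to zero.
    · rw [h, sub_self] at hfac ⊢
      rw [max_self]
      have hfac' := hfac.abs
      rw [abs_zero] at hfac'
      refine squeeze_zero_norm (fun t => ?_) hfac'
      rw [Real.norm_eq_abs, abs_mul]
      exact mul_le_of_le_one_right (abs_nonneg _) (abs_stdNormalCDF_le_one _)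
    · have hpos : 0 < y₀ - Real.log K := sub_pos.2 ((Real.log_lt_iff_lt_exp hK).2 h)
      have hD : Tendsto (fun t => logD₁ σ r K T t (y t)) (𝓝[<] T) atTop :=
        hnum.pos_mul_atTop hpos hsinv
      have hcdf : Tendsto (fun t => stdNormalCDF (logD₁ σ r K T t (y t))) (𝓝[<] T) (𝓝 1) :=
        (tendsto_cdf_atTop _).comp hD
      have := hfac.mul hcdf
      rwa [mul_one, ← max_eq_right (show 0 ≤ Real.exp y₀ - K by linarith)] at this
  have := hmain.add hdiff
  rw [add_zero] at this
  refine this.congr fun t => ?_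
  unfold logCallValue stockPart bondPart
  ring

end BlackScholes

/-! ### The hedge -/

section Hedge

variable {T : ℝ}

theorem leftCauchyIntegral_eq {l : PartitionSeq 0 T} {γ S Φ : ℝ → ℝ} (h0 : Φ 0 = 0)
    (h : ∀ u ∈ Ico 0 T, ∀ v ∈ Ico 0 T, u < v →
      Tendsto (germSum l (fun s t => γ s * (S t - S s)) u v) atTop (𝓝 (Φ v - Φ u)))
    {t : ℝ} (ht : t ∈ Ico 0 T) : leftCauchyIntegral l γ S 0 t = Φ t := by
  change limUnder atTop (germSum l (fun s t => γ s * (S t - S s)) 0 t) = Φ t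
  refine Tendsto.limUnder_eq ?_
  rcases ht.1.eq_or_lt with h' | h'
  · rw [← h', h0]
    refine tendsto_const_nhds.congr fun m => ?_
    rw [germSum_self l (by ring)]
  · have := h 0 ⟨le_rfl, h'.trans ht.2⟩ t ht h'
    rwa [h0, sub_zero] at this

/-- A continuous indefinite integral against a continuous price gives a trading strategy, and the
gain is the indefinite integral. -/
theorem isTradingStrategyFor_of_continuousOn {l : PartitionSeq 0 T} (hT : 0 < T)
    {γ S Φ : ℝ → ℝ} (hS : ContinuousOn S (Icc 0 T)) (hΦ : ContinuousOn Φ (Icc 0 T))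
    (h0 : Φ 0 = 0)
    (h : ∀ u ∈ Ico 0 T, ∀ v ∈ Ico 0 T, u < v →
      Tendsto (germSum l (fun s t => γ s * (S t - S s)) u v) atTop (𝓝 (Φ v - Φ u))) :
    IsTradingStrategyFor l γ S ∧ ∀ t ∈ Icc 0 T, gainIntegral l γ S t = Φ t := by
  -- Hence the existence of `γ(T-)` is immaterial; for the stock hedge it may fail when the final
  -- price is the strike.
  have hjump : leftJump 0 S T = 0 := leftJump_eq_zero_of_continuousOn hS le_rfl
  have hlim : Tendsto (fun u => leftCauchyIntegral l γ S 0 u) (𝓝[<] T) (𝓝 (Φ T)) := by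
    refine (tendsto_left_of_continuousOn hΦ ⟨hT, le_rfl⟩).congr' ?_
    filter_upwards [Ico_mem_nhdsLT hT] with t ht
    exact (leftCauchyIntegral_eq h0 h ht).symm
  refine ⟨⟨⟨Φ, isLeftCauchyIntegral_of_continuousOn Ico_subset_Icc_self hS hΦ h0 h⟩,
    fun _ => hjump, ⟨_, hlim⟩⟩, fun t ht => ?_⟩
  have hend : gainBeforeEnd l γ S = Φ T := hlim.limUnder_eq
  unfold gainIntegral
  rw [hjump, hend]
  split_ifs with h1 h2
  · exact leftCauchyIntegral_eq h0 h ⟨ht.1, h1⟩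
  · rw [le_antisymm ht.2 (not_lt.1 h1)]
    ring
  · rw [le_antisymm ht.2 (not_lt.1 h1)]

variable {σ r K : ℝ}

theorem callValue_exp (hK : 0 < K) {t : ℝ} (ht : t < T) (x : ℝ) :
    callValue σ r K T t (Real.exp x) = logCallValue σ r K T t x := by
  unfold callValue logCallValue stockPart bondPart logD₂ d₂
  rw [if_pos (Real.exp_pos x), if_pos ht, d₁_exp hK]

theorem callValue_maturity {x : ℝ} (hx : 0 < x) : callValue σ r K T T x = max 0 (x - K) := by
  unfold callValue
  rw [if_pos hx, if_neg (lt_irrefl T)]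

theorem continuousOn_callValue (hσ : 0 < σ) (hK : 0 < K) {y : ℝ → ℝ}
    (hy : ContinuousOn y (Icc 0 T)) :
    ContinuousOn (fun t => callValue σ r K T t (Real.exp (y t))) (Icc 0 T) := by
  intro t ht
  rcases ht.2.lt_or_eq with h | rfl
  · obtain ⟨d, htd, hdT⟩ := exists_between h
    have hc : ContinuousOn (fun s => logCallValue σ r K T s (y s)) (Icc 0 d) :=
      ((continuousOn_stockPart hσ hdT).sub (continuousOn_bondPart hσ hdT)).comp
        (continuousOn_id.prodMk (hy.mono (Icc_subset_Icc le_rfl hdT.le)))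
        fun s hs => ⟨hs, mem_univ _⟩
    have hc' : ContinuousOn (fun s => callValue σ r K T s (Real.exp (y s))) (Icc 0 d) :=
      hc.congr fun s hs => callValue_exp hK (hs.2.trans_lt hdT) _
    refine (hc' t ⟨ht.1, htd.le⟩).mono_of_mem_nhdsWithin ?_
    rw [mem_nhdsWithin]
    exact ⟨Iio d, isOpen_Iio, htd, fun s hs => ⟨hs.2.1, hs.1.le⟩⟩
  · rcases ht.1.eq_or_lt with h0 | h0
    · subst h0
      rw [Icc_self]
      exact continuousWithinAt_singleton
    · have hyl := tendsto_left_of_continuousOn hy ⟨h0, le_rfl⟩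
      have h1 : ContinuousWithinAt (fun s => callValue σ r K t s (Real.exp (y s))) (Iio t) t := by
        unfold ContinuousWithinAt
        simp only
        rw [callValue_maturity (Real.exp_pos _)]
        refine (tendsto_logCallValue (r := r) hσ hK hyl).congr' ?_
        filter_upwards [self_mem_nhdsWithin] with s hs
        exact (callValue_exp hK hs _).symm
      refine (continuousWithinAt_insert_self.2 h1).mono fun s hs => ?_
      exact hs.2.eq_or_lt.imp id id

/-- Continuity is available only on `[0,T)`, as `d₂` divides by `√(T-t)`; boundedness by `r K` takes
care of the endpoint. -/
theorem intervalIntegrable_bondPart (hσ : 0 < σ) (hr : 0 < r) (hK : 0 < K) (hT : 0 ≤ T) {y : ℝ → ℝ}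
    (hy : ContinuousOn y (Icc 0 T)) :
    IntervalIntegrable (fun t => r * bondPart σ r K T t (y t)) MeasureTheory.volume 0 T := by
  rw [intervalIntegrable_iff_integrableOn_Ico_of_le hT]
  have hc : ContinuousOn (fun t => r * bondPart σ r K T t (y t)) (Ico 0 T) := by
    intro t ht
    obtain ⟨d, htd, hdT⟩ := exists_between ht.2
    have hc : ContinuousOn (fun s => bondPart σ r K T s (y s)) (Icc 0 d) :=
      (continuousOn_bondPart hσ hdT).comp
        (continuousOn_id.prodMk (hy.mono (Icc_subset_Icc le_rfl hdT.le)))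
        fun s hs => ⟨hs, mem_univ _⟩
    refine ((continuousOn_const.mul hc) t ⟨ht.1, htd.le⟩).mono_of_mem_nhdsWithin ?_
    rw [mem_nhdsWithin]
    exact ⟨Iio d, isOpen_Iio, htd, fun s hs => ⟨hs.2.1, hs.1.le⟩⟩
  refine MeasureTheory.IntegrableOn.of_bound (by simp)
    (hc.aestronglyMeasurable measurableSet_Ico) (r * K) ?_
  refine (MeasureTheory.ae_restrict_iff' measurableSet_Ico).2 (Eventually.of_forall fun t ht => ?_)
  rw [Real.norm_eq_abs, abs_mul, abs_of_pos hr]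
  exact mul_le_mul_of_nonneg_left (abs_bondPart_le hr hK ht.2.le _) hr.le

/-- With `J` the primitive of `r bondPart` and `V` the option value along the path, the bond gains
`-J` and the stock gains `V - V 0 + J`. Both are continuous on the closed interval. -/
theorem hedge_gain {l : PartitionSeq 0 T} (hT : 0 < T) (hσ : 0 < σ) (hr : 0 < r) (hK : 0 < K)
    {y P : ℝ → ℝ} (hy : HasLinearQuadVar l y (σ ^ 2))
    (hP : ∀ t ∈ Icc 0 T, P t = Real.exp (y t)) :
    IsTradingStrategyFor l (hedgeBond σ r K T (bond r) P) (bond r) ∧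
      IsTradingStrategyFor l (hedgeStock σ r K T P) P ∧
      ∀ t ∈ Icc 0 T, gainIntegral l (hedgeBond σ r K T (bond r) P) (bond r) t
        + gainIntegral l (hedgeStock σ r K T P) P t
        = callValue σ r K T t (P t) - callValue σ r K T 0 (P 0) := by
  have hyc := hy.continuousOn
  have h0T : (0 : ℝ) ∈ Icc 0 T := ⟨le_rfl, hT.le⟩
  have hint := intervalIntegrable_bondPart (σ := σ) hσ hr hK hT.le hyc
  have hsub : ∀ u ∈ Icc 0 T, ∀ v ∈ Icc 0 T,
      IntervalIntegrable (fun t => r * bondPart σ r K T t (y t)) MeasureTheory.volume u v :=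
    fun u hu v hv => hint.mono_set (by rw [uIcc_of_le hT.le]; exact uIcc_subset_Icc hu hv)
  set J : ℝ → ℝ := fun t => ∫ s in (0 : ℝ)..t, r * bondPart σ r K T s (y s) with hJ
  have hJc : ContinuousOn J (Icc 0 T) := by
    have := intervalIntegral.continuousOn_primitive_interval' hint left_mem_uIcc
    rwa [uIcc_of_le hT.le] at this
  have hJ0 : J 0 = 0 := by simp [hJ]
  have hJd : ∀ u ∈ Icc 0 T, ∀ v ∈ Icc 0 T,
      ∫ s in u..v, r * bondPart σ r K T s (y s) = J v - J u := fun u hu v hv => by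
    have := intervalIntegral.integral_add_adjacent_intervals (hsub 0 h0T u hu) (hsub u hu v hv)
    simp only [hJ]
    linarith
  set V : ℝ → ℝ := fun t => callValue σ r K T t (P t) with hV
  have hVc : ContinuousOn V (Icc 0 T) :=
    (continuousOn_callValue hσ hK hyc).congr fun t ht => by simp only [hV]; rw [hP t ht]
  have hVlog : ∀ t ∈ Ico 0 T, V t = logCallValue σ r K T t (y t) := fun t ht => by
    simp only [hV]
    rw [hP t ⟨ht.1, ht.2.le⟩, callValue_exp hK ht.2]
  have hPc : ContinuousOn P (Icc 0 T) := (Real.continuous_exp.comp_continuousOn hyc).congr hP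
  have hbc : ContinuousOn (bond r) (Icc 0 T) := by unfold bond; fun_prop
  have hb := isTradingStrategyFor_of_continuousOn hT (l := l)
    (γ := hedgeBond σ r K T (bond r) P) (Φ := fun t => -J t) hbc hJc.neg (by simp [hJ0])
    (fun u hu v hv huv => by
      have h := tendsto_bond_gain (l := l) hσ hr hK hyc hP hu.1 huv.le hv.2
      rw [hJd u ⟨hu.1, hu.2.le⟩ v ⟨hv.1, hv.2.le⟩] at h
      convert h using 2
      ring)
  have hs := isTradingStrategyFor_of_continuousOn hT (l := l)
    (γ := hedgeStock σ r K T P) (Φ := fun t => V t - V 0 + J t) hPc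
    ((hVc.sub continuousOn_const).add hJc) (by simp [hJ0])
    (fun u hu v hv huv => by
      have h := tendsto_stock_gain (r := r) hσ hK hy hP hu.1 huv.le hv.2
      rw [hJd u ⟨hu.1, hu.2.le⟩ v ⟨hv.1, hv.2.le⟩, ← hVlog u hu, ← hVlog v hv] at h
      convert h using 2
      ring)
  refine ⟨hb.1, hs.1, fun t ht => ?_⟩
  rw [hb.2 t ht, hs.2 t ht]
  ring

theorem portfolioValue_bsHedge {P : ℝ → ℝ} {S : Fin 2 → ℝ → ℝ} (h0 : S 0 = bond r)
    (h1 : S 1 = P) (t : ℝ) :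
    portfolioValue (bsHedge σ r K T) S t = callValue σ r K T t (P t) := by
  have hne : bond r t ≠ 0 := (Real.exp_pos _).ne'
  simp only [portfolioValue, Fin.sum_univ_two, bsHedge, Matrix.cons_val_zero, Matrix.cons_val_one,
    h0, h1, hedgeBond]
  rw [div_mul_cancel₀ _ hne]
  ring

theorem hasLinearQuadVar_of_mem_mixedReturnClass {l : PartitionSeq 0 T} {p : ℝ} (hp : 1 ≤ p)
    (hp2 : p < 2) {w : ℝ → ℝ} (hw : w ∈ mixedReturnClass l p σ) :
    HasLinearQuadVar l w (σ ^ 2) ∧ w 0 = 0 := by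
  obtain ⟨g, hg, h, hh, hg0, hh0, rfl⟩ := hw
  refine ⟨(hasLinearQuadVar_of_bracket hg).add_zero
    (hh.2.hasLinearQuadVar_zero (by linarith) hp2 l hh.1), ?_⟩
  simp [hg0, hh0]

theorem isStock_bond (l : PartitionSeq 0 T) (hT : 0 < T) (r : ℝ) : IsStock l {bond r} := by
  refine isStock_of_hasLinearQuadVar (κ := 0) (X := {fun t => r * t}) hT le_rfl ?_ ?_ ?_
  · rintro _ rfl
    have hz : HasLinearQuadVar l (fun _ => 0) 0 := ⟨continuousOn_const, fun u _ v _ _ => by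
      rw [zero_mul]
      exact tendsto_const_nhds.congr fun m => by simp [germSum]⟩
    -- The return `r t` is the zero path minus the drift `-r t`, so the bond is the case `κ = 0` of
    -- an exponential price.
    have h := hz.sub_drift le_rfl (-r)
    simp only [zero_sub, neg_mul, neg_neg] at h
    exact ⟨h, mul_zero r⟩
  · rintro _ rfl
    exact ⟨_, rfl, fun t _ => by simp [bond]⟩
  · rintro _ rfl
    exact ⟨_, rfl, fun t _ => by simp [bond]⟩

end Hedge

end PathwiseBS

end

theorem mainTheorem12 (T : ℝ) (hT : 0 < T) (l : PathwiseBS.PartitionSeq 0 T)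
    (p σ r K : ℝ) (hp : 1 ≤ p) (hp2 : p < 2) (hσ : 0 < σ) (hr : 0 < r) (hK : 0 < K)
    (X : Set (ℝ → ℝ)) (hX : X ⊆ PathwiseBS.mixedReturnClass l p σ) :
    PathwiseBS.IsTradingStrategy l (PathwiseBS.bsPortfolio l r X)
        (PathwiseBS.bsHedge σ r K T) ∧
      PathwiseBS.IsSelfFinancing l (PathwiseBS.bsPortfolio l r X)
        (PathwiseBS.bsHedge σ r K T) ∧
      ∀ S, PathwiseBS.IsScenario (PathwiseBS.bsPortfolio l r X) S →
        PathwiseBS.portfolioValue (PathwiseBS.bsHedge σ r K T) S T = max 0 (S 1 T - K) := by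

  have hXq : ∀ w ∈ X, PathwiseBS.HasLinearQuadVar l w (σ ^ 2) ∧ w 0 = 0 := fun w hw =>
    PathwiseBS.hasLinearQuadVar_of_mem_mixedReturnClass hp hp2 (hX hw)
  have hdol : ∀ w ∈ X, ∀ t ∈ Icc 0 T,
      PathwiseBS.doleans l w t = Real.exp (w t - σ ^ 2 * t / 2) := fun w hw t ht =>
    (hXq w hw).1.doleans_eq (hXq w hw).2 ht
  have hscen : ∀ S, PathwiseBS.IsScenario (PathwiseBS.bsPortfolio l r X) S →
      S 0 = PathwiseBS.bond r ∧ ∃ w ∈ X, PathwiseBS.doleans l w = S 1 := fun S hS =>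
    ⟨hS 0, hS 1⟩
  -- The second conjunct is filled in by unification with `hedge_gain`, whose conclusion mentions
  -- the price but not the log path.
  have hgain : ∀ S, PathwiseBS.IsScenario (PathwiseBS.bsPortfolio l r X) S →
      (∀ t ∈ Icc 0 T, 0 < S 1 t) ∧ _ := fun S hS => by
    obtain ⟨-, w, hw, hwS⟩ := hscen S hS
    have hy : PathwiseBS.HasLinearQuadVar l (fun t => w t - σ ^ 2 / 2 * t) (σ ^ 2) :=
      (hXq w hw).1.sub_drift (sq_nonneg σ) _
    have hP : ∀ t ∈ Icc 0 T, S 1 t = Real.exp (w t - σ ^ 2 / 2 * t) := fun t ht => by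
      rw [← hwS, hdol w hw t ht]
      congr 1
      ring
    exact ⟨fun t ht => hP t ht ▸ Real.exp_pos _, PathwiseBS.hedge_gain hT hσ hr hK hy hP⟩
  refine ⟨⟨?_, ?_⟩, ?_, ?_⟩
  · refine Fin.forall_fin_two.2 ⟨PathwiseBS.isStock_bond l hT r, ?_⟩
    refine PathwiseBS.isStock_of_hasLinearQuadVar hT (sq_nonneg σ) hXq ?_ ?_
    · rintro _ ⟨w, hw, rfl⟩
      exact ⟨w, hw, hdol w hw⟩
    · exact fun w hw => ⟨_, ⟨w, hw, rfl⟩, hdol w hw⟩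
  · intro S hS
    obtain ⟨-, hb, hs, -⟩ := hgain S hS
    have h0 := (hscen S hS).1
    refine Fin.forall_fin_two.2 ⟨?_, ?_⟩
    · simpa [PathwiseBS.bsHedge, h0] using hb
    · simpa [PathwiseBS.bsHedge] using hs
  · intro S hS t ht
    obtain ⟨-, -, -, hg⟩ := hgain S hS
    have h0 := (hscen S hS).1
    rw [PathwiseBS.portfolioValue_bsHedge h0 rfl, PathwiseBS.portfolioValue_bsHedge h0 rfl]
    have := hg t ht
    simp only [PathwiseBS.portfolioGain, Fin.sum_univ_two, PathwiseBS.bsHedge,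
      Matrix.cons_val_zero, Matrix.cons_val_one, h0]
    linarith
  · intro S hS
    rw [PathwiseBS.portfolioValue_bsHedge (hscen S hS).1 rfl,
      PathwiseBS.callValue_maturity ((hgain S hS).1 T ⟨hT.le, le_rfl⟩)]
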